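/- Let $\mathcal H$ be a complex, separable, infinite-dimensional Hilbert space with orthonormal basis $\{e_n\}_{n\ge 1}$, and let $\{X_n\}_{n\ge 1}$ be nonnegative, bounded, i.i.d. random variables on a probability space $(\Omega,\mathcal F,\mathbb P)$. Let $R$ be the maximum of the essential range of $X_1$ (the support of its law), and assume $R=1$. Let $T=T(\omega)$ be the random weighted shift, i.e. the (almost surely bounded) linear operator on $\mathcal H$ with $Te_n=X_n(\omega)e_{n+1}$ for all $n\ge 1$. For a bounded operator $A\in B(\mathcal H)$, let $\mathscr A_A$, $\mathscr W_A$ and $\mathscr O_A$ (the Banach algebra, the weakly closed algebra and the dual algebra generated by $A$) be the closures of the set $\{p(A): p\in\mathbb C[z]\}$ in the norm topology, in the weak operator topology, and in the weak* topology of $B(\mathcal H)$ as the dual of the trace-class operators, respectively. Let $\{A\}'$ be the commutant of $A$ and $\{A\}''$ its double commutant (the set of bounded operators commuting with every element of $\{A\}'$). Let $\mathbb D$ be the open unit disk, let $\mathcal A(\mathbb D)$ be the disk algebra (continuous functions on $\overline{\mathbb D}$ that are holomorphic in $\mathbb D$) and let $H^\infty(\mathbb D)$ be the algebra of bounded holomorphic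 functions on $\mathbb D$, both with the supremum norm. "Isometrically isomorphic" means that there is an isometric isomorphism of complex algebras. Then: (i) Almost surely, $\mathscr A_T$ is isometrically isomorphic to $\mathcal A(\mathbb D)$. (ii) Almost surely, $\mathscr O_T=\mathscr W_T$. Moreover, if $\mathbb P(X_1=0)=0$, then almost surely $\mathscr O_T=\mathscr W_T=\{T\}'=\{T\}''$, and this algebra is isometrically isomorphic to $H^\infty(\mathbb D)$. -/

import Mathlib

open MeasureTheory ProbabilityTheory
open scoped BoundedContinuousFunction

namespace RandomShift

noncomputable section

/-- The essential range of a random variable: the support of its law. -/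
def essRange {Ω : Type*} [MeasurableSpace Ω] (X : Ω → ℝ) (P : Measure Ω) : Set ℝ :=
  (P.map X).support

section Operators

variable {H : Type*} [NormedAddCommGroup H] [InnerProductSpace ℂ H]

/-! ### Unilateral weighted shifts -/

/-- The coordinates of the image of `x` under the shift with weights `w`: `0` in position `0`,
and `w n * x n` in position `n + 1`. -/
def shiftCoord (w : ℕ → ℝ) (x : ℕ → ℂ) : ℕ → ℂ
  | 0 => 0
  | n + 1 => (w n : ℂ) * x n

theorem shiftCoord_bound {w : ℕ → ℝ} {C : ℝ} (hC : ∀ n, |w n| ≤ C)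
    (x : lp (fun _ : ℕ => ℂ) 2) :
    ∃ h : Memℓp (shiftCoord w (x : ℕ → ℂ)) 2,
      ‖(⟨shiftCoord w (x : ℕ → ℂ), h⟩ : lp (fun _ : ℕ => ℂ) 2)‖ ≤ C * ‖x‖ := by
  have hC0 : 0 ≤ C := (abs_nonneg _).trans (hC 0)
  have h2 : (0 : ℝ) < (2 : ENNReal).toReal := by norm_num
  have hx : HasSum (fun n => ‖(x : ℕ → ℂ) n‖ ^ (2 : ENNReal).toReal)
      (‖x‖ ^ (2 : ENNReal).toReal) := lp.hasSum_norm h2 x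
  simp only [ENNReal.toReal_ofNat, Real.rpow_ofNat] at hx
  have hle : ∀ n, ‖shiftCoord w (x : ℕ → ℂ) (n + 1)‖ ^ 2 ≤ C ^ 2 * ‖(x : ℕ → ℂ) n‖ ^ 2 := by
    intro n
    simp only [shiftCoord, norm_mul, Complex.norm_real, Real.norm_eq_abs, mul_pow]
    gcongr
    exact hC n
  have hs1 : Summable (fun n => ‖shiftCoord w (x : ℕ → ℂ) (n + 1)‖ ^ 2) :=
    Summable.of_nonneg_of_le (fun n => by positivity) hle (hx.summable.mul_left _)
  have hs : Summable (fun n => ‖shiftCoord w (x : ℕ → ℂ) n‖ ^ 2) :=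
    (summable_nat_add_iff (f := fun n => ‖shiftCoord w (x : ℕ → ℂ) n‖ ^ 2) 1).mp hs1
  have hmem : Memℓp (shiftCoord w (x : ℕ → ℂ)) 2 := by
    refine memℓp_gen ?_
    simpa only [ENNReal.toReal_ofNat, Real.rpow_ofNat] using hs
  refine ⟨hmem, ?_⟩
  refine lp.norm_le_of_tsum_le h2 (by positivity) ?_
  simp only [ENNReal.toReal_ofNat, Real.rpow_ofNat]
  rw [hs.tsum_eq_zero_add]
  have : ∑' n, ‖shiftCoord w (x : ℕ → ℂ) (n + 1)‖ ^ 2 ≤ C ^ 2 * ‖x‖ ^ 2 := by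
    rw [← hx.tsum_eq, ← tsum_mul_left]
    exact hs1.tsum_le_tsum hle (hx.summable.mul_left _)
  simpa [shiftCoord, mul_pow] using this

/-- The weighted shift on `ℓ²` with weights bounded by `C`. -/
def shiftLp (w : ℕ → ℝ) (C : ℝ) (hC : ∀ n, |w n| ≤ C) :
    lp (fun _ : ℕ => ℂ) 2 →L[ℂ] lp (fun _ : ℕ => ℂ) 2 :=
  LinearMap.mkContinuous
    { toFun := fun x => ⟨shiftCoord w (x : ℕ → ℂ), (shiftCoord_bound hC x).choose⟩
      map_add' := fun x y => by
        ext n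
        change shiftCoord w ((x : ℕ → ℂ) + (y : ℕ → ℂ)) n =
          shiftCoord w (x : ℕ → ℂ) n + shiftCoord w (y : ℕ → ℂ) n
        cases n <;> simp [shiftCoord, mul_add]
      map_smul' := fun c x => by
        ext n
        cases n <;> simp [shiftCoord, mul_left_comm] }
    C (fun x => (shiftCoord_bound hC x).choose_spec)

open Classical in
/-- The unilateral weighted shift with respect to the orthonormal basis `e` and the weights `w`:
the bounded operator with `e n ↦ w n • e (n + 1)` for all `n`. Its value for an unbounded weight
sequence, for which no such bounded operator exists, is `0`. -/
def weightedShift (e : HilbertBasis ℕ ℂ H) (w : ℕ → ℝ) : H →L[ℂ] H :=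
  if h : ∃ C : ℝ, ∀ n, |w n| ≤ C then
    (e.repr.symm.toContinuousLinearEquiv : lp (fun _ : ℕ => ℂ) 2 →L[ℂ] H) ∘L
      shiftLp w h.choose h.choose_spec ∘L
      (e.repr.toContinuousLinearEquiv : H →L[ℂ] lp (fun _ : ℕ => ℂ) 2)
  else 0

theorem weightedShift_apply_basis (e : HilbertBasis ℕ ℂ H) {w : ℕ → ℝ}
    (h : ∃ C : ℝ, ∀ n, |w n| ≤ C) (n : ℕ) :
    weightedShift e w (e n) = (w n : ℂ) • e (n + 1) := by
  apply e.repr.injective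
  rw [map_smul, e.repr_self]
  ext k
  have hk : (e.repr (weightedShift e w (e n)) : ℕ → ℂ) k =
      shiftCoord w (lp.single 2 n (1 : ℂ) : lp (fun _ : ℕ => ℂ) 2) k := by
    rw [← e.repr_self n]
    simp [weightedShift, h, shiftLp]
  rw [hk]
  change _ = (w n : ℂ) * (lp.single 2 (n + 1) (1 : ℂ) : lp (fun _ : ℕ => ℂ) 2) k
  cases k with
  | zero => simp [shiftCoord]
  | succ k =>
    rcases eq_or_ne k n with rfl | hne
    · simp [shiftCoord]
    · simp [shiftCoord, hne]

/-! ### Trace-class operators and the weak* topology of `B(H)` -/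

/-- Trace-class operators on a Hilbert space: the operators `S = ∑ₙ ⟨·, yₙ⟩ xₙ` with
`∑ₙ ‖xₙ‖ ‖yₙ‖ < ∞` (Mathlib's inner product is conjugate-linear in the first variable). -/
def IsTraceClass (S : H →L[ℂ] H) : Prop :=
  ∃ x y : ℕ → H, Summable (fun n => ‖x n‖ * ‖y n‖) ∧
    ∀ v : H, HasSum (fun n => inner ℂ (y n) v • x n) (S v)

/-- The trace `∑ₙ ⟨S eₙ, eₙ⟩` of an operator, computed in the orthonormal basis `e`; for a
trace-class operator the series converges absolutely and does not depend on the basis. -/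
def trace (e : HilbertBasis ℕ ℂ H) (S : H →L[ℂ] H) : ℂ :=
  ∑' n, inner ℂ (e n) (S (e n))

/-- The weak* topology of `B(H)`, as the dual space of the trace-class operators under the pairing
`(A, S) ↦ tr (A S)`: the coarsest topology that makes all functionals `A ↦ tr (A S)`,
`S` of trace class, continuous. -/
@[reducible] def weakStarTopology (e : HilbertBasis ℕ ℂ H) : TopologicalSpace (H →L[ℂ] H) :=
  ⨅ S : {S : H →L[ℂ] H // IsTraceClass S},
    TopologicalSpace.induced (fun A => trace e (A ∘L S.1)) inferInstance

/-! ### Algebras generated by an operator -/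

/-- The algebra of all polynomials in `A`. -/
def polynomialsIn (A : H →L[ℂ] H) : Subalgebra ℂ (H →L[ℂ] H) :=
  (Polynomial.aeval (R := ℂ) A).range

/-- The Banach algebra generated by `A`: the norm closure of the polynomials in `A`. -/
def banachAlgebraGen (A : H →L[ℂ] H) : Subalgebra ℂ (H →L[ℂ] H) :=
  (polynomialsIn A).topologicalClosure

/-- The weakly closed algebra generated by `A`: the closure of the polynomials in `A` in the
weak operator topology. -/
def weaklyClosedAlgebraGen (A : H →L[ℂ] H) : Set (H →L[ℂ] H) :=
  {B | ContinuousLinearMapWOT.ofCLM B ∈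
    closure (ContinuousLinearMapWOT.ofCLM '' (polynomialsIn A : Set (H →L[ℂ] H)))}

/-- The dual algebra generated by `A`: the closure of the polynomials in `A` in the weak*
topology. -/
def dualAlgebraGen (e : HilbertBasis ℕ ℂ H) (A : H →L[ℂ] H) : Set (H →L[ℂ] H) :=
  @closure _ (weakStarTopology e) (polynomialsIn A : Set (H →L[ℂ] H))

/-- The commutant of `A`: all bounded operators that commute with `A`. -/
def commutant (A : H →L[ℂ] H) : Subalgebra ℂ (H →L[ℂ] H) :=
  Subalgebra.centralizer ℂ {A}

/-- The double commutant of `A`: all bounded operators that commute with the commutant of `A`. -/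
def doubleCommutant (A : H →L[ℂ] H) : Subalgebra ℂ (H →L[ℂ] H) :=
  Subalgebra.centralizer ℂ (commutant A : Set (H →L[ℂ] H))

end Operators

/-! ### The disk algebra and `H^∞` of the unit disk -/

/-- A function on a set `s` of complex numbers that contains the open unit disk is holomorphic in
that disk. -/
def HolomorphicInDisk {s : Set ℂ} (f : s → ℂ) : Prop :=
  ∃ g : ℂ → ℂ, DifferentiableOn ℂ g (Metric.ball 0 1) ∧
    ∀ z : s, (z : ℂ) ∈ Metric.ball (0 : ℂ) 1 → f z = g z

/-- The disk algebra: continuous functions on the closed unit disk that are holomorphic in the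
open disk, with the supremum norm. -/
def diskAlgebra : Subalgebra ℂ C(Metric.closedBall (0 : ℂ) 1, ℂ) where
  carrier := {f | HolomorphicInDisk f}
  mul_mem' := by
    rintro a b ⟨f, hf, hf'⟩ ⟨g, hg, hg'⟩
    exact ⟨f * g, hf.mul hg, fun z hz => by simp [hf' z hz, hg' z hz]⟩
  add_mem' := by
    rintro a b ⟨f, hf, hf'⟩ ⟨g, hg, hg'⟩
    exact ⟨f + g, hf.add hg, fun z hz => by simp [hf' z hz, hg' z hz]⟩
  algebraMap_mem' := fun c => ⟨fun _ => c, differentiableOn_const c, fun z _ => by simp⟩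

/-- The algebra `H^∞` of bounded holomorphic functions on the open unit disk, with the supremum
norm. -/
def hardyInfty : Subalgebra ℂ (Metric.ball (0 : ℂ) 1 →ᵇ ℂ) where
  carrier := {f | HolomorphicInDisk f}
  mul_mem' := by
    rintro a b ⟨f, hf, hf'⟩ ⟨g, hg, hg'⟩
    exact ⟨f * g, hf.mul hg, fun z hz => by simp [hf' z hz, hg' z hz]⟩
  add_mem' := by
    rintro a b ⟨f, hf, hf'⟩ ⟨g, hg, hg'⟩
    exact ⟨f + g, hf.add hg, fun z hz => by simp [hf' z hz, hg' z hz]⟩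
  algebraMap_mem' := fun c => ⟨fun _ => c, differentiableOn_const c, fun z _ => rfl⟩

end

end RandomShift

/-!
Write the operators in question as formal sums `∑ₖ aₖ Tᵏ` with symbol `φ = ∑ₖ aₖ zᵏ`. For constant
weights `1` such a sum is the lower triangular Toeplitz matrix of `φ`, which is bounded by `C` if
and only if `φ` is a holomorphic function on the disk with `|φ| ≤ C`. Passing to other weights of
modulus at most `1` does not increase the norm: the matrix is affine in each single weight, and
changing the sign of a weight is a unitary conjugation. Conversely, by the second Borel–Cantelli
lemma the weights almost surely have arbitrarily long runs close to `1` in modulus, and the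
compressions of `∑ₖ aₖ Tᵏ` to these runs recover the norm of the Toeplitz matrix. Hence
`φ ↦ ∑ₖ aₖ Tᵏ` is an isometric functional calculus on `H^∞`, and it maps the disk algebra, the
closure of the polynomials, onto the Banach algebra generated by `T`.

That an operator has the form `∑ₖ aₖ Tᵏ` is a system of linear equations between its matrix
entries, so the range of the calculus is closed in the weak operator and the weak* topology. It is
contained in both closures of the polynomials in `T`, because every `φ` in `H^∞` is a limit of
bounded polynomials. If no weight vanishes, an operator commuting with `T` is determined by its
value at `e 0` and has the form `∑ₖ aₖ Tᵏ`; the range is then the commutant of `T`, and since it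
is commutative, it is also the double commutant.
-/

namespace RandomShift

open Filter Finset
open scoped Topology PowerSeries ComplexConjugate

local notation "𝔻" => Metric.ball (0 : ℂ) 1

section Probability

variable {Ω E : Type*} [MeasurableSpace Ω] [MeasurableSpace E] {P : Measure Ω}

/-- The event that all variables with indices in the `i`-th block of `K` consecutive natural
numbers take values in `s`. -/
def blockEvent (X : ℕ → Ω → E) (s : Set E) (K i : ℕ) : Set Ω :=
  ⋂ j : Fin K, X (i * K + j) ⁻¹' s

theorem measurableSet_blockEvent {X : ℕ → Ω → E} (hmeas : ∀ n, Measurable (X n)) {s : Set E}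
    (hs : MeasurableSet s) (K i : ℕ) : MeasurableSet (blockEvent X s K i) :=
  .iInter fun _ => hmeas _ hs

theorem measure_biInter_blockEvent {X : ℕ → Ω → E} (hindep : iIndepFun X P)
    (hident : ∀ n, IdentDistrib (X n) (X 0) P P) {s : Set E} (hs : MeasurableSet s)
    (K : ℕ) (t : Finset ℕ) :
    P (⋂ i ∈ t, blockEvent X s K i) = ∏ _i ∈ t, P (X 0 ⁻¹' s) ^ K := by
  rcases K.eq_zero_or_pos with rfl | hK
  · have := hindep.isProbabilityMeasure
    simp [blockEvent]
  have : NeZero K := ⟨hK.ne'⟩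
  have hY := hindep.precomp (Nat.divModEquiv K).symm.injective
  have hblocks : ⋂ i ∈ t, blockEvent X s K i =
      ⋂ p ∈ t ×ˢ (univ : Finset (Fin K)), X ((Nat.divModEquiv K).symm p) ⁻¹' s := by
    ext ω
    simp only [blockEvent, Set.mem_iInter, mem_product, mem_univ, and_true,
      Nat.divModEquiv_symm_apply, Prod.forall]
    exact ⟨fun h i j hi => h i hi j, fun h i hi j => h i j hi⟩
  rw [hblocks, hY.meas_biInter (s := fun p => X ((Nat.divModEquiv K).symm p) ⁻¹' s)
    fun p _ => ⟨s, hs, rfl⟩, prod_product]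
  simp [(hident _).measure_mem_eq hs]

theorem iIndepSet_blockEvent {X : ℕ → Ω → E} (hmeas : ∀ n, Measurable (X n))
    (hindep : iIndepFun X P) (hident : ∀ n, IdentDistrib (X n) (X 0) P P) {s : Set E}
    (hs : MeasurableSet s) (K : ℕ) : iIndepSet (blockEvent X s K) P := by
  refine (iIndepSet_iff_meas_biInter (measurableSet_blockEvent hmeas hs K)).2 fun t => ?_
  rw [measure_biInter_blockEvent hindep hident hs]
  refine prod_congr rfl fun i _ => ?_
  simpa using (measure_biInter_blockEvent hindep hident hs K {i}).symm

theorem ae_exists_run {X : ℕ → Ω → E} (hmeas : ∀ n, Measurable (X n)) (hindep : iIndepFun X P)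
    (hident : ∀ n, IdentDistrib (X n) (X 0) P P) {s : Set E} (hs : MeasurableSet s)
    (hpos : P (X 0 ⁻¹' s) ≠ 0) (K : ℕ) : ∀ᵐ ω ∂P, ∃ N, ∀ j < K, X (N + j) ω ∈ s := by
  have := hindep.isProbabilityMeasure
  have hprob : ∀ i, P (blockEvent X s K i) = P (X 0 ⁻¹' s) ^ K := fun i => by
    simpa using measure_biInter_blockEvent hindep hident hs K {i}
  have hlimsup : P (limsup (blockEvent X s K) atTop) = 1 :=
    measure_limsup_eq_one (measurableSet_blockEvent hmeas hs K)
      (iIndepSet_blockEvent hmeas hindep hident hs K) <| by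
        simpa only [hprob] using ENNReal.tsum_const_eq_top_of_ne_zero (pow_ne_zero K hpos)
  have hae := (mem_ae_iff_prob_eq_one (.measurableSet_limsup
    (measurableSet_blockEvent hmeas hs K))).2 hlimsup
  filter_upwards [hae] with ω hω
  obtain ⟨i, hi⟩ := (mem_limsup_iff_frequently_mem.1 hω).exists
  exact ⟨i * K, fun j hj => Set.mem_iInter.1 hi ⟨j, hj⟩⟩

/-- The sequence `w` has arbitrarily long runs of consecutive entries whose moduli are larger than
any given number below `1`. -/
def HasUnitRuns (w : ℕ → ℝ) : Prop :=
  ∀ (K : ℕ) (ε : ℝ), 0 < ε → ∃ N, ∀ j < K, 1 - ε < |w (N + j)|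

theorem essRange_congr {X Y : Ω → ℝ} (h : X =ᵐ[P] Y) : essRange X P = essRange Y P :=
  congrArg Measure.support (Measure.map_congr h)

theorem ae_hasUnitRuns {X : ℕ → Ω → ℝ} (hmeas : ∀ n, Measurable (X n)) (hindep : iIndepFun X P)
    (hident : ∀ n, IdentDistrib (X n) (X 0) P P) (hR : 1 ∈ essRange (fun ω => |X 0 ω|) P) :
    ∀ᵐ ω ∂P, HasUnitRuns fun n => X n ω := by
  have hrun : ∀ K n : ℕ, ∀ᵐ ω ∂P, ∃ N, ∀ j < K,
      X (N + j) ω ∈ {x | 1 - 1 / ((n : ℝ) + 1) < |x|} := by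
    intro K n
    refine ae_exists_run hmeas hindep hident (measurableSet_lt (by fun_prop) (by fun_prop)) ?_ K
    have hmap := Measure.map_apply (μ := P) (hmeas 0).abs
      (measurableSet_Ioi (a := 1 - 1 / ((n : ℝ) + 1)))
    refine hmap ▸ ((Measure.mem_support_iff_forall 1).1 hR _ (Ioi_mem_nhds ?_)).ne'
    exact sub_lt_self _ Nat.one_div_pos_of_nat
  filter_upwards [ae_all_iff.2 fun K => ae_all_iff.2 (hrun K)] with ω hω K ε hε
  obtain ⟨n, hn⟩ := exists_nat_one_div_lt hε
  obtain ⟨N, hN⟩ := hω K n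
  exact ⟨N, fun j hj => (sub_lt_sub_left hn 1).trans (hN j hj)⟩

theorem ae_forall_of_identDistrib {X : ℕ → Ω → E} (hident : ∀ n, IdentDistrib (X n) (X 0) P P)
    {p : E → Prop} (hp : MeasurableSet {x | p x}) (h : ∀ᵐ ω ∂P, p (X 0 ω)) :
    ∀ᵐ ω ∂P, ∀ n, p (X n ω) :=
  ae_all_iff.2 fun n => (hident n).symm.ae_mem_snd hp h

theorem ae_le_of_mem_upperBounds_essRange {Y : Ω → ℝ} (hY : AEMeasurable Y P) {R : ℝ}
    (hR : R ∈ upperBounds (essRange Y P)) : ∀ᵐ ω ∂P, Y ω ≤ R :=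
  ae_of_ae_map hY <| mem_of_superset Measure.support_mem_ae fun _ hx => hR hx

end Probability

section SymbolBound

/-- The product of the weights in positions `n, …, m - 1`: the factor by which the `(m - n)`-th
power of the weighted shift maps `e n` to `e m`. -/
noncomputable def weightProd (w : ℕ → ℝ) (n m : ℕ) : ℂ := ∏ j ∈ Ico n m, (w j : ℂ)

@[simp] theorem weightProd_self (w : ℕ → ℝ) (n : ℕ) : weightProd w n n = 1 := by
  simp [weightProd]

@[simp] theorem weightProd_one (n m : ℕ) : weightProd 1 n m = 1 := by
  simp [weightProd]

theorem weightProd_mul_weightProd (w : ℕ → ℝ) {l n m : ℕ} (h : l ≤ n) (h' : n ≤ m) :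
    weightProd w l n * weightProd w n m = weightProd w l m :=
  prod_Ico_consecutive _ h h'

theorem weightProd_ne_zero {w : ℕ → ℝ} (hw : ∀ j, w j ≠ 0) (n m : ℕ) : weightProd w n m ≠ 0 :=
  prod_ne_zero_iff.2 fun j _ => Complex.ofReal_ne_zero.2 (hw j)

theorem weightProd_update (w : ℕ → ℝ) (j : ℕ) (c : ℝ) (n m : ℕ) :
    weightProd (Function.update w j (c * w j)) n m =
      (if j ∈ Ico n m then (c : ℂ) else 1) * weightProd w n m := by
  have hfactor : ∀ i, ((Function.update w j (c * w j) i : ℝ) : ℂ) =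
      (if j = i then (c : ℂ) else 1) * w i := by
    intro i
    rcases eq_or_ne j i with rfl | hne
    · simp
    · simp [hne, hne.symm]
  simp only [weightProd, hfactor, prod_mul_distrib, prod_ite_eq]

/-- The `m`-th coordinate of `∑ₖ aₖ Tᵏ x`, where `aₖ` are the coefficients of `φ` and `T` is the
weighted shift with weights `w` acting on complex sequences. -/
noncomputable def symbolCoord (w : ℕ → ℝ) (φ : ℂ⟦X⟧) (x : ℕ → ℂ) (m : ℕ) : ℂ :=
  ∑ p ∈ antidiagonal m, PowerSeries.coeff p.1 φ * weightProd w p.2 m * x p.2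

/-- The lower triangular matrix of `∑ₖ aₖ Tᵏ`, where `aₖ` are the coefficients of `φ` and `T` is the
weighted shift with weights `w`, is bounded by `C` on `ℓ²`. -/
def SymbolBound (w : ℕ → ℝ) (φ : ℂ⟦X⟧) (C : ℝ) : Prop :=
  ∀ (M : ℕ) (x : ℕ → ℂ),
    ∑ m ∈ range M, ‖symbolCoord w φ x m‖ ^ 2 ≤ C ^ 2 * ∑ m ∈ range M, ‖x m‖ ^ 2

variable {w : ℕ → ℝ} {φ : ℂ⟦X⟧} {C : ℝ}

theorem SymbolBound.of_tendsto {ι : Type*} {l : Filter ι} [l.NeBot] {w' : ι → ℕ → ℝ}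
    {φ' : ι → ℂ⟦X⟧} {C' : ι → ℝ} (h : ∀ i, SymbolBound (w' i) (φ' i) (C' i))
    (hw : Tendsto w' l (𝓝 w))
    (hφ : ∀ k, Tendsto (fun i => PowerSeries.coeff k (φ' i)) l (𝓝 (PowerSeries.coeff k φ)))
    (hC : Tendsto C' l (𝓝 C)) : SymbolBound w φ C := by
  intro M x
  have hprod : ∀ n m, Tendsto (fun i => weightProd (w' i) n m) l (𝓝 (weightProd w n m)) :=
    fun n m => tendsto_finsetProd _ fun j _ =>
      (Complex.continuous_ofReal.tendsto _).comp (tendsto_pi_nhds.1 hw j)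
  have hcoord : ∀ m, Tendsto (fun i => symbolCoord (w' i) (φ' i) x m) l
      (𝓝 (symbolCoord w φ x m)) := fun m =>
    tendsto_finsetSum _ fun p _ => ((hφ p.1).mul (hprod p.2 m)).mul_const _
  exact le_of_tendsto_of_tendsto' (tendsto_finsetSum _ fun m _ => (hcoord m).norm.pow 2)
    ((hC.pow 2).mul_const _) fun i => h i M x

/-- Changing the sign of the weight in position `j` amounts to conjugation by the diagonal unitary
that changes the signs of the basis vectors in positions `> j`. -/
theorem SymbolBound.update_neg (h : SymbolBound w φ C) (j : ℕ) :
    SymbolBound (Function.update w j (-1 * w j)) φ C := by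
  intro M x
  set σ : ℕ → ℂ := fun m => if j < m then -1 else 1
  have hσ : ∀ m z, ‖σ m * z‖ = ‖z‖ := fun m z => by
    by_cases hm : j < m <;> simp [σ, hm]
  have hprod : ∀ n m, n ≤ m → weightProd (Function.update w j (-1 * w j)) n m =
      σ m * weightProd w n m * σ n := by
    intro n m hnm
    rw [weightProd_update]
    by_cases hn : j < n
    · simp [σ, hn, hn.trans_le hnm, hn.not_ge]
    · by_cases hm : j < m <;> simp [σ, hn, hm, not_lt.1 hn]
  have hcoord : ∀ m, symbolCoord (Function.update w j (-1 * w j)) φ x m =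
      σ m * symbolCoord w φ (fun n => σ n * x n) m := by
    intro m
    simp only [symbolCoord, mul_sum]
    refine sum_congr rfl fun p hp => ?_
    rw [hprod p.2 m (HasAntidiagonal.antidiagonal.snd_le hp)]
    ring
  simpa only [hcoord, hσ] using h M fun n => σ n * x n

theorem norm_sq_convex_combination_le {E : Type*} [SeminormedAddCommGroup E] [NormedSpace ℝ E]
    {t : ℝ} (ht : |t| ≤ 1) (x y : E) :
    ‖((1 + t) / 2) • x + ((1 - t) / 2) • y‖ ^ 2 ≤
      (1 + t) / 2 * ‖x‖ ^ 2 + (1 - t) / 2 * ‖y‖ ^ 2 := by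
  have hconv : ConvexOn ℝ Set.univ fun z : E => ‖z‖ ^ 2 :=
    convexOn_univ_norm.pow (fun _ _ => norm_nonneg _) 2
  obtain ⟨ht₁, ht₂⟩ := abs_le.1 ht
  exact hconv.2 (Set.mem_univ x) (Set.mem_univ y) (by linarith) (by linarith) (by ring)

/-- The matrix is affine in each single weight, so that a bound for it persists when the weight
moves inside the segment between a value and its negative. -/
theorem SymbolBound.update_mul (h : SymbolBound w φ C) (j : ℕ) {t : ℝ} (ht : |t| ≤ 1) :
    SymbolBound (Function.update w j (t * w j)) φ C := by
  intro M x
  have hcoord : ∀ m, symbolCoord (Function.update w j (t * w j)) φ x m =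
      ((1 + t) / 2) • symbolCoord w φ x m +
        ((1 - t) / 2) • symbolCoord (Function.update w j (-1 * w j)) φ x m := by
    intro m
    simp only [symbolCoord, weightProd_update, smul_sum, ← sum_add_distrib, Complex.real_smul]
    refine sum_congr rfl fun p _ => ?_
    split_ifs <;> push_cast <;> ring
  obtain ⟨ht₁, ht₂⟩ := abs_le.1 ht
  calc ∑ m ∈ range M, ‖symbolCoord (Function.update w j (t * w j)) φ x m‖ ^ 2
      ≤ ∑ m ∈ range M, ((1 + t) / 2 * ‖symbolCoord w φ x m‖ ^ 2 +
          (1 - t) / 2 * ‖symbolCoord (Function.update w j (-1 * w j)) φ x m‖ ^ 2) := by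
        simp only [hcoord]
        exact sum_le_sum fun m _ => norm_sq_convex_combination_le ht _ _
    _ ≤ (1 + t) / 2 * (C ^ 2 * ∑ m ∈ range M, ‖x m‖ ^ 2) +
          (1 - t) / 2 * (C ^ 2 * ∑ m ∈ range M, ‖x m‖ ^ 2) := by
        rw [sum_add_distrib, ← mul_sum, ← mul_sum]
        exact add_le_add (mul_le_mul_of_nonneg_left (h M x) (by linarith))
          (mul_le_mul_of_nonneg_left (h.update_neg j M x) (by linarith))
    _ = C ^ 2 * ∑ m ∈ range M, ‖x m‖ ^ 2 := by ring

theorem SymbolBound.mul_weights (h : SymbolBound w φ C) {t : ℕ → ℝ} (ht : ∀ j, |t j| ≤ 1) :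
    SymbolBound (t * w) φ C := by
  have hfinite : ∀ M, SymbolBound (fun j => if j < M then t j * w j else w j) φ C := by
    intro M
    induction M with
    | zero => simpa using h
    | succ M ih =>
      convert ih.update_mul M (ht M) using 1
      ext j
      rcases lt_trichotomy j M with hj | rfl | hj
      · simp [hj, hj.ne, hj.trans M.lt_succ_self]
      · simp
      · simp [hj.ne', hj.not_gt, hj.not_ge]
  refine .of_tendsto (l := atTop) hfinite (tendsto_pi_nhds.2 fun j => ?_)
    (fun _ => tendsto_const_nhds) tendsto_const_nhds
  refine tendsto_const_nhds.congr' ?_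
  filter_upwards [eventually_gt_atTop j] with M hM using by simp [hM]

end SymbolBound

section Toeplitz

open Polynomial

theorem symbolCoord_one (φ : ℂ⟦X⟧) (x : ℕ → ℂ) (m : ℕ) :
    symbolCoord 1 φ x m = PowerSeries.coeff m (φ * PowerSeries.mk x) := by
  simp [symbolCoord, PowerSeries.coeff_mul]

theorem sum_sq_norm_coeff_mul_le (p q : ℂ[X]) {C : ℝ} (hC : ∀ z : ℂ, ‖z‖ = 1 → ‖p.eval z‖ ≤ C)
    (s : Finset ℕ) :
    ∑ k ∈ s, ‖(p * q).coeff k‖ ^ 2 ≤ C ^ 2 * ∑ k ∈ q.support, ‖q.coeff k‖ ^ 2 := by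
  have hint : ∀ r : ℂ[X], CircleIntegrable (fun z => ‖r.eval z‖ ^ 2) 0 1 := fun r =>
    (r.continuous.norm.pow 2).continuousOn.circleIntegrable'
  calc ∑ k ∈ s, ‖(p * q).coeff k‖ ^ 2
      = ∑ k ∈ s with k ∈ (p * q).support, ‖(p * q).coeff k‖ ^ 2 :=
        (sum_filter_of_ne fun k _ hk => mem_support_iff.2 fun h => hk (by simp [h])).symm
    _ ≤ ∑ k ∈ (p * q).support, ‖(p * q).coeff k‖ ^ 2 :=
        sum_le_sum_of_subset_of_nonneg (fun k hk => (mem_filter.1 hk).2) fun _ _ _ => by positivity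
    _ = Real.circleAverage (fun z => ‖(p * q).eval z‖ ^ 2) 0 1 :=
        sum_sq_norm_coeff_eq_circleAverage _
    _ ≤ Real.circleAverage (fun z => C ^ 2 • ‖q.eval z‖ ^ 2) 0 1 := by
        refine Real.circleAverage_mono (hint _) (hint q).const_fun_smul fun z hz => ?_
        rw [eval_mul, norm_mul, mul_pow, smul_eq_mul]
        gcongr
        exact hC z (by simpa using hz)
    _ = C ^ 2 * ∑ k ∈ q.support, ‖q.coeff k‖ ^ 2 := by
        rw [Real.circleAverage_fun_smul, sum_sq_norm_coeff_eq_circleAverage, smul_eq_mul]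

theorem SymbolBound.of_polynomial (p : ℂ[X]) {C : ℝ} (hC : ∀ z : ℂ, ‖z‖ = 1 → ‖p.eval z‖ ≤ C) :
    SymbolBound 1 (p : ℂ⟦X⟧) C := by
  intro M x
  set q := PowerSeries.trunc M (PowerSeries.mk x)
  have hpq : ∀ m ∈ range M, symbolCoord 1 (p : ℂ⟦X⟧) x m = (p * q).coeff m := by
    intro m hm
    have htrunc := congrArg (coeff · m) (PowerSeries.trunc_mul_trunc (n := M) p (PowerSeries.mk x))
    simp only [PowerSeries.coeff_trunc, mem_range.1 hm, if_true] at htrunc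
    rw [symbolCoord_one, ← htrunc, ← coeff_coe, Polynomial.coe_mul]
  have hq : ∑ k ∈ q.support, ‖q.coeff k‖ ^ 2 = ∑ m ∈ range M, ‖x m‖ ^ 2 := by
    have hsupp : q.support ⊆ range M := fun k hk => by
      by_contra hkM
      exact mem_support_iff.1 hk (by simp [q, PowerSeries.coeff_trunc, mem_range.not.1 hkM])
    rw [sum_subset hsupp fun k _ hk => by simp [notMem_support_iff.1 hk]]
    exact sum_congr rfl fun k hk => by simp [q, PowerSeries.coeff_trunc, mem_range.1 hk]
  calc ∑ m ∈ range M, ‖symbolCoord 1 (p : ℂ⟦X⟧) x m‖ ^ 2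
      = ∑ m ∈ range M, ‖(p * q).coeff m‖ ^ 2 := sum_congr rfl fun m hm => by rw [hpq m hm]
    _ ≤ C ^ 2 * ∑ m ∈ range M, ‖x m‖ ^ 2 := hq ▸ sum_sq_norm_coeff_mul_le p q hC _

theorem SymbolBound.norm_coeff_le {φ : ℂ⟦X⟧} {C : ℝ} (h : SymbolBound 1 φ C) (hC : 0 ≤ C) (k : ℕ) :
    ‖PowerSeries.coeff k φ‖ ≤ C := by
  have hcoord : symbolCoord 1 φ (Pi.single 0 1) k = PowerSeries.coeff k φ := by
    have hone : PowerSeries.mk (Pi.single 0 1 : ℕ → ℂ) = 1 := by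
      ext n
      simp [PowerSeries.coeff_one, Pi.single_apply]
    rw [symbolCoord_one, hone, mul_one]
  have hM := h (k + 1) (Pi.single 0 1)
  have hnorm : ∑ m ∈ range (k + 1), ‖(Pi.single 0 1 : ℕ → ℂ) m‖ ^ 2 = 1 := by
    simp [Pi.single_apply, apply_ite norm, ite_pow]
  rw [hnorm, mul_one] at hM
  have hk := single_le_sum (f := fun m => ‖symbolCoord 1 φ (Pi.single 0 1) m‖ ^ 2)
    (fun _ _ => by positivity) (self_mem_range_succ k)
  exact hcoord ▸ le_of_sq_le_sq (hk.trans hM) hC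

theorem SymbolBound.summable {φ : ℂ⟦X⟧} {C : ℝ} (h : SymbolBound 1 φ C) (hC : 0 ≤ C) {z : ℂ}
    (hz : ‖z‖ < 1) : Summable fun k => PowerSeries.coeff k φ * z ^ k := by
  refine .of_norm_bounded ((summable_geometric_of_lt_one (norm_nonneg z) hz).mul_left C) fun k => ?_
  rw [norm_mul, norm_pow]
  gcongr
  exact h.norm_coeff_le hC k

/-- The sequence `zⁿ` is an eigenvector of the transposed Toeplitz matrix for the eigenvalue
`φ(z)`. -/
theorem SymbolBound.norm_tsum_le {φ : ℂ⟦X⟧} {C : ℝ} (h : SymbolBound 1 φ C) (hC : 0 ≤ C)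
    {z : ℂ} (hz : ‖z‖ < 1) : ‖∑' k, PowerSeries.coeff k φ * z ^ k‖ ≤ C := by
  set x : ℕ → ℂ := fun n => conj z ^ n
  set S : ℕ → ℝ := fun M => ∑ n ∈ range M, ‖x n‖ ^ 2
  have hzz : ‖z * conj z‖ < 1 := by
    simpa using mul_lt_one_of_nonneg_of_lt_one_left (norm_nonneg z) hz hz.le
  have hgeom : Summable fun n => ‖(z * conj z) ^ n‖ := (summable_geometric_of_norm_lt_one hzz).norm
  have hS : Tendsto S atTop (𝓝 ‖∑' n, (z * conj z) ^ n‖) := by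
    have hcast : ∀ M, ∑ n ∈ range M, (z * conj z) ^ n = (S M : ℂ) := fun M => by
      simp [S, x, Complex.mul_conj', ← pow_mul, mul_comm]
    have hS0 : ∀ M, 0 ≤ S M := fun M => sum_nonneg fun _ _ => by positivity
    simpa only [hcast, Complex.norm_real, Real.norm_of_nonneg (hS0 _)] using
      hgeom.of_norm.hasSum.tendsto_sum_nat.norm
  have hterm : ∀ m, ∑ p ∈ antidiagonal m,
      PowerSeries.coeff p.1 φ * z ^ p.1 * (z * conj z) ^ p.2 = z ^ m * symbolCoord 1 φ x m := by
    intro m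
    simp only [symbolCoord, weightProd_one, mul_one, mul_sum]
    refine sum_congr rfl fun p hp => ?_
    rw [← HasAntidiagonal.mem_antidiagonal.1 hp, pow_add, mul_pow]
    ring
  have hseries := (h.summable hC hz).norm
  have hsum := (summable_norm_sum_mul_antidiagonal_of_summable_norm hseries hgeom).of_norm.hasSum
  rw [← tsum_mul_tsum_eq_tsum_sum_antidiagonal_of_summable_norm hseries hgeom] at hsum
  simp only [hterm] at hsum
  have hpartial : ∀ M, ‖∑ m ∈ range M, z ^ m * symbolCoord 1 φ x m‖ ≤ C * S M := by
    intro M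
    refine (norm_sum_le _ _).trans (le_of_sq_le_sq ?_ (by positivity))
    calc (∑ m ∈ range M, ‖z ^ m * symbolCoord 1 φ x m‖) ^ 2
        = (∑ m ∈ range M, ‖x m‖ * ‖symbolCoord 1 φ x m‖) ^ 2 := by simp [x]
      _ ≤ S M * ∑ m ∈ range M, ‖symbolCoord 1 φ x m‖ ^ 2 := sum_mul_sq_le_sq_mul_sq _ _ _
      _ ≤ S M * (C ^ 2 * S M) := by gcongr; exact h M x
      _ = (C * S M) ^ 2 := by ring
  have hle := le_of_tendsto_of_tendsto' hsum.tendsto_sum_nat.norm (hS.const_mul C) hpartial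
  rw [norm_mul] at hle
  refine le_of_mul_le_mul_right hle (norm_pos_iff.2 ?_)
  rw [tsum_geometric_of_norm_lt_one hzz]
  exact inv_ne_zero (sub_ne_zero.2 fun hone => by simp [← hone] at hzz)

end Toeplitz

section Taylor

open Polynomial

/-- The power series `φ` converges to `f` at every point of the open unit disk. -/
def HasTaylorSeries (f : 𝔻 → ℂ) (φ : ℂ⟦X⟧) : Prop :=
  ∀ z : 𝔻, HasSum (fun k => PowerSeries.coeff k φ * (z : ℂ) ^ k) (f z)

variable {f g : 𝔻 → ℂ} {φ ψ : ℂ⟦X⟧}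

theorem HasTaylorSeries.add (hf : HasTaylorSeries f φ) (hg : HasTaylorSeries g ψ) :
    HasTaylorSeries (f + g) (φ + ψ) := fun z => by
  simpa [add_mul] using (hf z).add (hg z)

theorem HasTaylorSeries.mul (hf : HasTaylorSeries f φ) (hg : HasTaylorSeries g ψ) :
    HasTaylorSeries (f * g) (φ * ψ) := by
  intro z
  have hsum := (summable_norm_sum_mul_antidiagonal_of_summable_norm (hf z).summable.norm
    (hg z).summable.norm).of_norm.hasSum
  rw [← tsum_mul_tsum_eq_tsum_sum_antidiagonal_of_summable_norm (hf z).summable.norm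
    (hg z).summable.norm, (hf z).tsum_eq, (hg z).tsum_eq] at hsum
  refine hsum.congr_fun fun k => ?_
  rw [PowerSeries.coeff_mul, sum_mul]
  refine sum_congr rfl fun p hp => ?_
  rw [← HasAntidiagonal.mem_antidiagonal.1 hp, pow_add]
  ring

theorem hasTaylorSeries_polynomial (p : ℂ[X]) :
    HasTaylorSeries (fun z => p.eval (z : ℂ)) (p : ℂ⟦X⟧) := by
  intro z
  simp only [coeff_coe, eval_eq_sum, Polynomial.sum]
  exact hasSum_sum_of_ne_finset_zero fun k hk => by simp [notMem_support_iff.1 hk]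

theorem HasTaylorSeries.hasFPowerSeriesOnBall (h : HasTaylorSeries f φ) {F : ℂ → ℂ}
    (hF : ∀ z : 𝔻, F z = f z) :
    HasFPowerSeriesOnBall F (.ofScalars ℂ fun k => PowerSeries.coeff k φ) 0 1 where
  r_le := by
    refine ENNReal.le_of_forall_nnreal_lt fun r hr => ?_
    refine FormalMultilinearSeries.le_radius_of_summable _ ?_
    have hr' : ((r : ℝ) : ℂ) ∈ 𝔻 := by simpa using hr
    simpa using (h ⟨_, hr'⟩).summable.norm
  r_pos := one_pos
  hasSum := by
    intro y hy
    have hy' : y ∈ 𝔻 := by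
      rw [← Metric.eball_ofReal]
      simpa using hy
    simpa [FormalMultilinearSeries.ofScalars_apply_eq, mul_comm, hF ⟨y, hy'⟩] using h ⟨y, hy'⟩

theorem extend_val_zero_apply (f : 𝔻 → ℂ) (z : 𝔻) :
    Function.extend Subtype.val f 0 (z : ℂ) = f z :=
  Subtype.val_injective.extend_apply f 0 z

theorem HasTaylorSeries.unique (hφ : HasTaylorSeries f φ) (hψ : HasTaylorSeries f ψ) : φ = ψ := by
  have hφ' := (hφ.hasFPowerSeriesOnBall (extend_val_zero_apply f)).hasFPowerSeriesAt
  have hψ' := (hψ.hasFPowerSeriesOnBall (extend_val_zero_apply f)).hasFPowerSeriesAt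
  exact PowerSeries.ext <| congrFun <| FormalMultilinearSeries.ofScalars_series_injective ℂ ℂ <|
    hφ'.eq_formalMultilinearSeries hψ'

theorem HasTaylorSeries.holomorphicInDisk (h : HasTaylorSeries f φ) : HolomorphicInDisk f := by
  refine ⟨_, ?_, fun z _ => (extend_val_zero_apply f z).symm⟩
  have hdiff := (h.hasFPowerSeriesOnBall (extend_val_zero_apply f)).differentiableOn
  rwa [← ENNReal.ofReal_one, Metric.eball_ofReal] at hdiff

theorem HolomorphicInDisk.continuous (h : HolomorphicInDisk f) : Continuous f := by
  obtain ⟨g, hg, hfg⟩ := h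
  exact hg.continuousOn.domRestrict.congr fun z => (hfg z z.2).symm

theorem HolomorphicInDisk.exists_hasTaylorSeries {s : Set ℂ} {F : s → ℂ}
    (h : HolomorphicInDisk F) (hs : 𝔻 ⊆ s) :
    ∃ φ, HasTaylorSeries (F ∘ Set.inclusion hs) φ := by
  obtain ⟨g, hg, hFg⟩ := h
  refine ⟨.mk fun k => (k.factorial : ℂ)⁻¹ * iteratedDeriv k g 0, fun z => ?_⟩
  have hval : (F ∘ Set.inclusion hs) z = g z := hFg _ z.2
  rw [hval]
  refine (Complex.hasSum_taylorSeries_on_ball hg z.2).congr_fun fun k => ?_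
  simp only [PowerSeries.coeff_mk, sub_zero, smul_eq_mul]
  ring

theorem ofReal_mul_mem_ball {r : ℝ} (hr0 : 0 ≤ r) (hr1 : r < 1) {z : ℂ} (hz : ‖z‖ ≤ 1) :
    (r : ℂ) * z ∈ 𝔻 := by
  rw [mem_ball_zero_iff, norm_mul, Complex.norm_real, Real.norm_of_nonneg hr0]
  exact mul_lt_one_of_nonneg_of_lt_one_left hr0 hr1 hz

theorem HasTaylorSeries.tendstoUniformlyOn_trunc_rescale (h : HasTaylorSeries f φ) {r : ℝ}
    (hr0 : 0 ≤ r) (hr1 : r < 1) :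
    TendstoUniformlyOn (fun K z => ((PowerSeries.rescale (r : ℂ) φ).trunc K).eval z)
      (fun z => ∑' k, PowerSeries.coeff k φ * (r * z) ^ k) atTop (Metric.closedBall 0 1) := by
  have hr : (r : ℂ) ∈ 𝔻 := by simpa using ofReal_mul_mem_ball hr0 hr1 norm_one.le
  refine (tendstoUniformlyOn_tsum_nat (h ⟨r, hr⟩).summable.norm fun k z hz => ?_).congr
    (.of_forall fun K z _ => ?_)
  · rw [mul_pow, ← mul_assoc, norm_mul, norm_pow z]
    exact mul_le_of_le_one_right (norm_nonneg _)
      (pow_le_one₀ (norm_nonneg _) (mem_closedBall_zero_iff.1 hz))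
  · simp only [eval, PowerSeries.eval₂_trunc_eq_sum_range, RingHom.id_apply,
      PowerSeries.coeff_rescale]
    exact sum_congr rfl fun k _ => by ring

theorem HasTaylorSeries.exists_polynomial_near_dilation (h : HasTaylorSeries f φ) {r : ℝ}
    (hr0 : 0 ≤ r) (hr1 : r < 1) {ε : ℝ} (hε : 0 < ε) (M : ℕ) : ∃ p : ℂ[X],
      (∀ k < M, p.coeff k = (r : ℂ) ^ k * PowerSeries.coeff k φ) ∧
      ∀ z : ℂ, ‖z‖ ≤ 1 → ∀ u : 𝔻, (u : ℂ) = r * z → ‖p.eval z - f u‖ ≤ ε := by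
  obtain ⟨K, hKM, hK⟩ := ((eventually_ge_atTop M).and
    (Metric.tendstoUniformlyOn_iff.1 (h.tendstoUniformlyOn_trunc_rescale hr0 hr1) ε hε)).exists
  refine ⟨(PowerSeries.rescale (r : ℂ) φ).trunc K, fun k hk => ?_, fun z hz u hu => ?_⟩
  · rw [PowerSeries.coeff_trunc, if_pos (hk.trans_le hKM), PowerSeries.coeff_rescale]
  · have hdist := hK z (mem_closedBall_zero_iff.2 hz)
    rw [← hu, (h u).tsum_eq, dist_comm, dist_eq_norm] at hdist
    exact hdist.le

theorem HasTaylorSeries.exists_polynomial_approx (h : HasTaylorSeries f φ) {C : ℝ}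
    (hC : ∀ z, ‖f z‖ ≤ C) : ∃ p : ℕ → ℂ[X],
      (∀ j z, ‖z‖ ≤ 1 → ‖(p j).eval z‖ ≤ C + 1 / ((j : ℝ) + 1)) ∧
      ∀ k, Tendsto (fun j => (p j).coeff k) atTop (𝓝 (PowerSeries.coeff k φ)) := by
  set r : ℕ → ℝ := fun j => 1 - 1 / ((j : ℝ) + 1)
  have hr1 : ∀ j, r j < 1 := fun j => sub_lt_self 1 Nat.one_div_pos_of_nat
  have hr0 : ∀ j, 0 ≤ r j := fun j => sub_nonneg.2 <|
    div_le_one_of_le₀ (le_add_of_nonneg_left j.cast_nonneg) (by positivity)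
  have hr : Tendsto r atTop (𝓝 1) := by
    simpa [r] using tendsto_const_nhds.sub (tendsto_one_div_add_atTop_nhds_zero_nat (𝕜 := ℝ))
  choose p hpcoeff hpeval using fun j =>
    h.exists_polynomial_near_dilation (hr0 j) (hr1 j) Nat.one_div_pos_of_nat j
  refine ⟨p, fun j z hz => ?_, fun k => ?_⟩
  · have hu := ofReal_mul_mem_ball (hr0 j) (hr1 j) hz
    exact (norm_le_norm_add_norm_sub' _ (f ⟨_, hu⟩)).trans
      (add_le_add (hC _) (hpeval j z hz ⟨_, hu⟩ rfl))
  · have hlim := (((Complex.continuous_ofReal.tendsto 1).comp hr).pow k).mul_const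
      (PowerSeries.coeff k φ)
    rw [Complex.ofReal_one, one_pow, one_mul] at hlim
    refine hlim.congr' ?_
    filter_upwards [eventually_gt_atTop k] with j hj
    exact (hpcoeff j k hj).symm

theorem HasTaylorSeries.symbolBound (h : HasTaylorSeries f φ) {C : ℝ} (hC : ∀ z, ‖f z‖ ≤ C) :
    SymbolBound 1 φ C := by
  obtain ⟨p, hp, hcoeff⟩ := h.exists_polynomial_approx hC
  refine .of_tendsto (fun j => SymbolBound.of_polynomial (p j) fun z hz => hp j z hz.le)
    tendsto_const_nhds (by simpa only [coeff_coe] using hcoeff) ?_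
  simpa using tendsto_const_nhds.add (tendsto_one_div_add_atTop_nhds_zero_nat (𝕜 := ℝ))

end Taylor

section HardyInfty

open Polynomial

theorem exists_hasTaylorSeries_hardyInfty (f : hardyInfty) : ∃ φ, HasTaylorSeries f.1 φ :=
  HolomorphicInDisk.exists_hasTaylorSeries f.2 subset_rfl

/-- The Taylor series at `0` of a bounded holomorphic function on the unit disk. -/
noncomputable def taylorSeries : hardyInfty →ₐ[ℂ] ℂ⟦X⟧ :=
  have spec := fun f => (exists_hasTaylorSeries_hardyInfty f).choose_spec
  have hconst : ∀ c : ℂ, HasTaylorSeries (algebraMap ℂ hardyInfty c).1 (PowerSeries.C c) :=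
    fun c => by simpa [HasTaylorSeries] using hasTaylorSeries_polynomial (C c)
  { toFun f := (exists_hasTaylorSeries_hardyInfty f).choose
    map_one' := by simpa using (spec _).unique (hconst 1)
    map_mul' f g := (spec _).unique ((spec f).mul (spec g))
    map_zero' := by simpa using (spec _).unique (hconst 0)
    map_add' f g := (spec _).unique ((spec f).add (spec g))
    commutes' c := (spec _).unique (hconst c) }

theorem hasTaylorSeries_taylorSeries (f : hardyInfty) : HasTaylorSeries f.1 (taylorSeries f) :=
  (exists_hasTaylorSeries_hardyInfty f).choose_spec

theorem taylorSeries_eq_iff {f : hardyInfty} {φ : ℂ⟦X⟧} :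
    taylorSeries f = φ ↔ HasTaylorSeries f.1 φ :=
  ⟨fun h => h ▸ hasTaylorSeries_taylorSeries f, (hasTaylorSeries_taylorSeries f).unique⟩

theorem taylorSeries_injective : Function.Injective taylorSeries := by
  intro f g hfg
  refine Subtype.ext (DFunLike.ext _ _ fun z => ?_)
  exact (hasTaylorSeries_taylorSeries f z).unique (taylorSeries_eq_iff.1 hfg.symm z)

theorem HasTaylorSeries.exists_hardyInfty {f : 𝔻 → ℂ} {φ : ℂ⟦X⟧} (h : HasTaylorSeries f φ) {C : ℝ}
    (hC : ∀ z, ‖f z‖ ≤ C) : ∃ F : hardyInfty, (∀ z, F.1 z = f z) ∧ taylorSeries F = φ := by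
  let F : 𝔻 →ᵇ ℂ := .ofNormedAddCommGroup f h.holomorphicInDisk.continuous C hC
  exact ⟨⟨F, h.holomorphicInDisk⟩, fun _ => rfl, taylorSeries_eq_iff.2 h⟩

theorem symbolBound_one_iff {φ : ℂ⟦X⟧} {C : ℝ} (hC : 0 ≤ C) :
    SymbolBound 1 φ C ↔ ∃ f : hardyInfty, ‖f‖ ≤ C ∧ taylorSeries f = φ := by
  constructor
  · intro h
    have hsum : HasTaylorSeries (fun z => ∑' k, PowerSeries.coeff k φ * (z : ℂ) ^ k) φ :=
      fun z => (h.summable hC (mem_ball_zero_iff.1 z.2)).hasSum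
    have hle := fun z : 𝔻 => h.norm_tsum_le hC (mem_ball_zero_iff.1 z.2)
    obtain ⟨f, hf, hfφ⟩ := hsum.exists_hardyInfty hle
    exact ⟨f, (BoundedContinuousFunction.norm_le hC).2 fun z => hf z ▸ hle z, hfφ⟩
  · rintro ⟨f, hf, rfl⟩
    exact (hasTaylorSeries_taylorSeries f).symbolBound fun z => (f.1.norm_coe_le_norm z).trans hf

end HardyInfty

section DiskAlgebra

open Polynomial

theorem HolomorphicInDisk.differentiableOn_extend {s : Set ℂ} {f : s → ℂ}
    (h : HolomorphicInDisk f) (hs : 𝔻 ⊆ s) :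
    DifferentiableOn ℂ (Function.extend Subtype.val f 0) 𝔻 := by
  obtain ⟨g, hg, hfg⟩ := h
  refine hg.congr fun z hz => ?_
  rw [← hfg ⟨z, hs hz⟩ hz]
  exact Subtype.val_injective.extend_apply f 0 ⟨z, hs hz⟩

theorem isClosed_diskAlgebra :
    IsClosed (diskAlgebra : Set C(Metric.closedBall (0 : ℂ) 1, ℂ)) := by
  refine IsSeqClosed.isClosed fun f g hf hfg => ?_
  set F : C(Metric.closedBall (0 : ℂ) 1, ℂ) → ℂ → ℂ := fun f => Function.extend Subtype.val f 0
  have hF : ∀ f (z : Metric.closedBall (0 : ℂ) 1), F f z = f z := fun f z =>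
    Subtype.val_injective.extend_apply f 0 z
  have hlim : TendstoUniformlyOn (fun n => F (f n)) (F g) atTop 𝔻 := by
    refine Metric.tendstoUniformlyOn_iff.2 fun ε hε => ?_
    filter_upwards [Metric.tendstoUniformly_iff.1
      (ContinuousMap.tendsto_iff_tendstoUniformly.1 hfg) ε hε] with n hn z hz
    simpa only [← hF] using hn ⟨z, Metric.ball_subset_closedBall hz⟩
  exact ⟨F g, hlim.tendstoLocallyUniformlyOn.differentiableOn (.of_forall fun n =>
    (hf n).differentiableOn_extend Metric.ball_subset_closedBall) Metric.isOpen_ball,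
    fun z _ => (hF g z).symm⟩

instance : CompleteSpace diskAlgebra := isClosed_diskAlgebra.completeSpace_coe

/-- The coordinate function `z ↦ z` of the disk algebra. -/
def diskCoordinate : diskAlgebra :=
  ⟨⟨fun z => (z : ℂ), continuous_subtype_val⟩, id, differentiableOn_id, fun _ _ => rfl⟩

theorem aeval_diskCoordinate_apply (p : ℂ[X]) (z : Metric.closedBall (0 : ℂ) 1) :
    (aeval diskCoordinate p).1 z = p.eval (z : ℂ) := by
  have h := aeval_algHom_apply ((ContinuousMap.evalAlgHom ℂ ℂ z).comp diskAlgebra.val)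
    diskCoordinate p
  rw [← coe_aeval_eq_eval]
  exact h.symm

theorem exists_dilation_near {f : Metric.closedBall (0 : ℂ) 1 → ℂ}
    (hf : Continuous f) {ε : ℝ} (hε : 0 < ε) : ∃ r : ℝ, 0 ≤ r ∧ r < 1 ∧
      ∀ z u : Metric.closedBall (0 : ℂ) 1, (u : ℂ) = r * z → ‖f u - f z‖ ≤ ε := by
  obtain ⟨δ, hδ, hfδ⟩ := Metric.uniformContinuous_iff.1
    (CompactSpace.uniformContinuous_of_continuous hf) ε hε
  refine ⟨max 0 (1 - δ / 2), le_max_left _ _, max_lt one_pos (by linarith), fun z u hu => ?_⟩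
  set r : ℝ := max 0 (1 - δ / 2)
  have hr : 0 ≤ 1 - r := sub_nonneg.2 (max_le zero_le_one (by linarith))
  rw [← dist_eq_norm]
  refine (hfδ ?_).le
  calc dist u z = (1 - r) * ‖(z : ℂ)‖ := by
        rw [Subtype.dist_eq, dist_comm, dist_eq_norm, hu, ← one_sub_mul, norm_mul,
          ← Complex.ofReal_one, ← Complex.ofReal_sub, Complex.norm_real, Real.norm_of_nonneg hr]
    _ ≤ 1 - r := mul_le_of_le_one_right hr (mem_closedBall_zero_iff.1 z.2)
    _ < δ := by linarith [le_max_right 0 (1 - δ / 2)]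

theorem denseRange_aeval_diskCoordinate :
    DenseRange fun p : ℂ[X] => aeval diskCoordinate p := by
  refine Metric.denseRange_iff.2 fun f ε hε => ?_
  obtain ⟨r, hr0, hr1, hr⟩ := exists_dilation_near f.1.continuous (by positivity : 0 < ε / 3)
  obtain ⟨φ, hφ⟩ := HolomorphicInDisk.exists_hasTaylorSeries f.2 Metric.ball_subset_closedBall
  obtain ⟨p, -, hp⟩ :=
    hφ.exists_polynomial_near_dilation hr0 hr1 (by positivity : 0 < ε / 3) 0
  refine ⟨p, ?_⟩
  have hle : dist f (aeval diskCoordinate p) ≤ ε / 3 + ε / 3 := by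
    refine (ContinuousMap.dist_le (by positivity)).2 fun z => ?_
    have hz := mem_closedBall_zero_iff.1 z.2
    have hu := ofReal_mul_mem_ball hr0 hr1 hz
    refine (dist_triangle_left _ _ (f.1 ⟨r * z, Metric.ball_subset_closedBall hu⟩)).trans ?_
    rw [dist_eq_norm, dist_comm, dist_eq_norm, aeval_diskCoordinate_apply]
    exact add_le_add (hr z _ rfl) (hp z hz ⟨_, hu⟩ rfl)
  linarith

/-- Restriction of functions from the closed to the open unit disk. -/
noncomputable def restrictDisk : diskAlgebra →ₐ[ℂ] hardyInfty where
  toFun f := ⟨(BoundedContinuousFunction.mkOfCompact f.1).compContinuous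
    ⟨Set.inclusion Metric.ball_subset_closedBall, continuous_inclusion _⟩, by
      obtain ⟨g, hg, hfg⟩ := f.2
      exact ⟨g, hg, fun z hz => hfg ⟨z, Metric.ball_subset_closedBall z.2⟩ hz⟩⟩
  map_one' := rfl
  map_mul' _ _ := rfl
  map_zero' := rfl
  map_add' _ _ := rfl
  commutes' _ := rfl

theorem norm_restrictDisk (f : diskAlgebra) : ‖restrictDisk f‖ = ‖f‖ := by
  refine le_antisymm ((BoundedContinuousFunction.norm_le (norm_nonneg _)).2 fun z =>
    f.1.norm_coe_le_norm _) ((ContinuousMap.norm_le _ (norm_nonneg _)).2 fun z => ?_)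
  have hdense : DenseRange
      (Set.inclusion (Metric.ball_subset_closedBall (x := (0 : ℂ)) (ε := 1))) :=
    (denseRange_inclusion_iff _).2 (closure_ball (0 : ℂ) one_ne_zero).ge
  exact hdense.induction_on z (isClosed_le f.1.continuous.norm continuous_const)
    fun u => (restrictDisk f).1.norm_coe_le_norm u

theorem isometry_restrictDisk : Isometry restrictDisk :=
  AddMonoidHomClass.isometry_of_norm _ norm_restrictDisk

theorem taylorSeries_restrictDisk_diskCoordinate :
    taylorSeries (restrictDisk diskCoordinate) = PowerSeries.X := by
  have hX : HasTaylorSeries (fun z => (z : ℂ)) PowerSeries.X := by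
    simpa using hasTaylorSeries_polynomial X
  exact taylorSeries_eq_iff.2 hX

theorem exists_isometric_algEquiv {A B : Type*} [NormedRing A] [NormedAlgebra ℂ A]
    [NormedRing B] [NormedAlgebra ℂ B] {Θ : A →ₐ[ℂ] B} (hΘ : Isometry Θ) {S : Subalgebra ℂ B}
    (hS : Θ.range = S) : ∃ φ : S ≃ₐ[ℂ] A, Isometry φ := by
  subst hS
  have hiso : Isometry (AlgEquiv.ofInjective Θ hΘ.injective) := fun x y => hΘ x y
  exact ⟨_, hiso.right_inv (AlgEquiv.ofInjective Θ hΘ.injective).apply_symm_apply⟩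

theorem range_eq_banachAlgebraGen {A H : Type*} [NormedRing A] [NormedAlgebra ℂ A] [CompleteSpace A]
    [NormedAddCommGroup H] [InnerProductSpace ℂ H] {Θ : A →ₐ[ℂ] (H →L[ℂ] H)} (hΘ : Isometry Θ)
    {a : A} (ha : DenseRange fun p : ℂ[X] => aeval a p) : Θ.range = banachAlgebraGen (Θ a) := by
  have hpoly : ∀ p, Θ (aeval a p) ∈ polynomialsIn (Θ a) := fun p => ⟨p, aeval_algHom_apply Θ a p⟩
  apply le_antisymm
  · rintro _ ⟨x, rfl⟩
    exact map_mem_closure hΘ.continuous (ha x) (Set.forall_mem_range.2 hpoly)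
  · refine Subalgebra.topologicalClosure_minimal ?_ hΘ.isClosedEmbedding.isClosed_range
    rintro _ ⟨p, rfl⟩
    exact ⟨aeval a p, (aeval_algHom_apply Θ a p).symm⟩

end DiskAlgebra

section Symbol

variable {w : ℕ → ℝ} {φ ψ : ℂ⟦X⟧} {C : ℝ}

theorem symbolCoord_add (w : ℕ → ℝ) (φ ψ : ℂ⟦X⟧) (x : ℕ → ℂ) :
    symbolCoord w (φ + ψ) x = symbolCoord w φ x + symbolCoord w ψ x := by
  ext m
  simp [symbolCoord, add_mul, sum_add_distrib]

theorem symbolCoord_add_right (w : ℕ → ℝ) (φ : ℂ⟦X⟧) (x y : ℕ → ℂ) :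
    symbolCoord w φ (x + y) = symbolCoord w φ x + symbolCoord w φ y := by
  ext m
  simp [symbolCoord, mul_add, sum_add_distrib]

theorem symbolCoord_smul_right (w : ℕ → ℝ) (φ : ℂ⟦X⟧) (c : ℂ) (x : ℕ → ℂ) :
    symbolCoord w φ (c • x) = c • symbolCoord w φ x := by
  ext m
  simp [symbolCoord, mul_sum, mul_left_comm]

theorem symbolCoord_symbolCoord (w : ℕ → ℝ) (φ ψ : ℂ⟦X⟧) (x : ℕ → ℂ) :
    symbolCoord w φ (symbolCoord w ψ x) = symbolCoord w (φ * ψ) x := by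
  ext m
  simp only [symbolCoord, PowerSeries.coeff_mul, mul_sum, sum_mul, sum_sigma']
  refine sum_nbij' (fun q => ⟨(q.1.1 + q.2.1, q.2.2), (q.1.1, q.2.1)⟩)
    (fun q => ⟨(q.2.1, q.2.2 + q.1.2), (q.2.2, q.1.2)⟩) ?_ ?_ ?_ ?_ ?_
  all_goals
    rintro ⟨⟨i, j⟩, ⟨k, l⟩⟩ h
    simp only [mem_sigma, HasAntidiagonal.mem_antidiagonal] at h ⊢
    obtain ⟨rfl, rfl⟩ := h
  on_goal 5 =>
    rw [← weightProd_mul_weightProd w (Nat.le_add_left l k) (Nat.le_add_left (k + l) i)]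
    ring
  all_goals simp [add_assoc]

theorem symbolCoord_shiftCoord_one (w : ℕ → ℝ) (φ : ℂ⟦X⟧) (x : ℕ → ℂ) (m : ℕ) :
    symbolCoord w φ (shiftCoord 1 x) (m + 1) = symbolCoord (fun j => w (j + 1)) φ x m := by
  have hprod : ∀ n, weightProd w (n + 1) (m + 1) = weightProd (fun j => w (j + 1)) n m :=
    fun n => (prod_Ico_add' (fun j => (w j : ℂ)) n m 1).symm
  simp [symbolCoord, Nat.sum_antidiagonal_succ', shiftCoord, hprod]

theorem SymbolBound.tail (h : SymbolBound w φ C) (N : ℕ) :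
    SymbolBound (fun j => w (N + j)) φ C := by
  induction N with
  | zero => simpa using h
  | succ N ih =>
    intro M x
    have hshift := ih (M + 1) (shiftCoord 1 x)
    simp only [sum_range_succ', symbolCoord_shiftCoord_one] at hshift
    simpa [symbolCoord, shiftCoord, add_right_comm, add_assoc] using hshift

variable {H : Type*} [NormedAddCommGroup H] [InnerProductSpace ℂ H] {e : HilbertBasis ℕ ℂ H}
  {A B : H →L[ℂ] H}

theorem ext_hilbertBasis {κ F : Type*} (e : HilbertBasis κ ℂ H) [TopologicalSpace F] [T2Space F]
    [AddCommMonoid F] [Module ℂ F] {A B : H →L[ℂ] F} (h : ∀ n, A (e n) = B (e n)) : A = B := by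
  refine ContinuousLinearMap.ext_on (s := Set.range e) ?_ (Set.eqOn_range.2 (funext h))
  exact Submodule.dense_iff_topologicalClosure_eq_top.2 e.dense_span

/-- In the coordinates of the basis `e`, the operator `B` is the formal sum `∑ₖ aₖ Tᵏ`, where `aₖ`
are the coefficients of `φ` and `T` is the weighted shift with weights `w`. -/
def HasSymbol (e : HilbertBasis ℕ ℂ H) (w : ℕ → ℝ) (B : H →L[ℂ] H) (φ : ℂ⟦X⟧) : Prop :=
  ∀ v, (e.repr (B v) : ℕ → ℂ) = symbolCoord w φ (e.repr v)

theorem symbolCoord_basis (e : HilbertBasis ℕ ℂ H) (w : ℕ → ℝ) (φ : ℂ⟦X⟧) (m n : ℕ) :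
    symbolCoord w φ (e.repr (e n)) m =
      if n ≤ m then PowerSeries.coeff (m - n) φ * weightProd w n m else 0 := by
  have hcoord : ∀ k, (e.repr (e n) : ℕ → ℂ) k = if k = n then 1 else 0 := fun k => by
    simp [e.repr_self, Pi.single_apply]
  rw [symbolCoord]
  simp only [hcoord, mul_ite, mul_one, mul_zero]
  split_ifs with h
  · rw [sum_eq_single_of_mem (m - n, n) (by simp [h]), if_pos rfl]
    intro p hp hne
    have hpm := HasAntidiagonal.mem_antidiagonal.1 hp
    exact if_neg fun hpn => hne (Prod.ext (by lia) hpn)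
  · refine sum_eq_zero fun p hp => if_neg ?_
    rintro rfl
    exact h (HasAntidiagonal.antidiagonal.snd_le hp)

theorem hasSymbol_iff_basis : HasSymbol e w B φ ↔
    ∀ n, (e.repr (B (e n)) : ℕ → ℂ) = symbolCoord w φ (e.repr (e n)) := by
  refine ⟨fun h n => h (e n), fun h v => funext fun m => ?_⟩
  let coord := fun n => innerSL ℂ (e n)
  have heq : coord m ∘L B =
      ∑ p ∈ antidiagonal m, (PowerSeries.coeff p.1 φ * weightProd w p.2 m) • coord p.2 :=
    ext_hilbertBasis e fun n => by
      simpa [symbolCoord, coord, e.repr_apply_apply] using congrFun (h n) m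
  simpa [symbolCoord, coord, e.repr_apply_apply] using DFunLike.congr_fun heq v

theorem hasSymbol_iff_entries : HasSymbol e w B φ ↔ ∀ m n,
    inner ℂ (e m) (B (e n)) =
      if n ≤ m then PowerSeries.coeff (m - n) φ * weightProd w n m else 0 := by
  simp only [hasSymbol_iff_basis, funext_iff, symbolCoord_basis, e.repr_apply_apply]
  exact forall_comm

theorem HasSymbol.unique (hA : HasSymbol e w A φ) (hB : HasSymbol e w B φ) : A = B :=
  ContinuousLinearMap.ext fun v => e.repr.injective <| lp.ext <| (hA v).trans (hB v).symm

theorem HasSymbol.add (hA : HasSymbol e w A φ) (hB : HasSymbol e w B ψ) :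
    HasSymbol e w (A + B) (φ + ψ) := by
  intro v
  rw [_root_.add_apply, map_add, lp.coeFn_add, hA, hB]
  exact (symbolCoord_add w φ ψ _).symm

theorem HasSymbol.mul (hA : HasSymbol e w A φ) (hB : HasSymbol e w B ψ) :
    HasSymbol e w (A * B) (φ * ψ) := by
  intro v
  rw [mul_apply_eq_comp, hA, hB, symbolCoord_symbolCoord]

theorem hasSymbol_algebraMap (e : HilbertBasis ℕ ℂ H) (w : ℕ → ℝ) (c : ℂ) :
    HasSymbol e w (algebraMap ℂ (H →L[ℂ] H) c) (PowerSeries.C c) := by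
  intro v
  ext m
  rw [symbolCoord, sum_eq_single_of_mem (0, m) (by simp)]
  · simp [Algebra.algebraMap_eq_smul_one]
  · rintro ⟨_ | k, l⟩ hp hne
    · simp_all
    · simp

theorem hasSymbol_weightedShift (e : HilbertBasis ℕ ℂ H) (hw : ∃ C : ℝ, ∀ n, |w n| ≤ C) :
    HasSymbol e w (weightedShift e w) PowerSeries.X := by
  refine hasSymbol_iff_entries.2 fun m n => ?_
  rw [weightedShift_apply_basis e hw, inner_smul_right, orthonormal_iff_ite.1 e.orthonormal]
  rcases eq_or_ne m (n + 1) with rfl | hm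
  · simp [weightProd]
  · have hne : m - n ≠ 1 := by lia
    simp [hm, PowerSeries.coeff_X, hne]

/-- The bounded operators of the form `∑ₖ aₖ Tᵏ`, where `T` is the weighted shift with
weights `w`. -/
def symbolAlgebra (e : HilbertBasis ℕ ℂ H) (w : ℕ → ℝ) : Subalgebra ℂ (H →L[ℂ] H) where
  carrier := {B | ∃ φ, HasSymbol e w B φ}
  mul_mem' := fun ⟨_, hA⟩ ⟨_, hB⟩ => ⟨_, hA.mul hB⟩
  add_mem' := fun ⟨_, hA⟩ ⟨_, hB⟩ => ⟨_, hA.add hB⟩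
  algebraMap_mem' := fun c => ⟨_, hasSymbol_algebraMap e w c⟩

theorem commute_of_mem_symbolAlgebra (hA : A ∈ symbolAlgebra e w) (hB : B ∈ symbolAlgebra e w) :
    Commute A B := by
  obtain ⟨φ, hφ⟩ := hA
  obtain ⟨ψ, hψ⟩ := hB
  exact (hφ.mul hψ).unique (mul_comm ψ φ ▸ hψ.mul hφ)

theorem SymbolBound.exists_lp (h : SymbolBound w φ C) (hC : 0 ≤ C) (x : lp (fun _ : ℕ => ℂ) 2) :
    ∃ y : lp (fun _ : ℕ => ℂ) 2, (y : ℕ → ℂ) = symbolCoord w φ x ∧ ‖y‖ ≤ C * ‖x‖ := by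
  have hp : 0 < (2 : ENNReal).toReal := by norm_num
  have hbound : ∀ s : Finset ℕ,
      ∑ m ∈ s, ‖symbolCoord w φ x m‖ ^ (2 : ENNReal).toReal ≤
        (C * ‖x‖) ^ (2 : ENNReal).toReal := by
    intro s
    have hbessel := fun M => lp.sum_rpow_le_norm_rpow hp x (range M)
    simp only [ENNReal.toReal_ofNat, Real.rpow_ofNat] at hbessel ⊢
    obtain ⟨M, hM⟩ := s.exists_nat_subset_range
    calc ∑ m ∈ s, ‖symbolCoord w φ x m‖ ^ 2
        ≤ ∑ m ∈ range M, ‖symbolCoord w φ x m‖ ^ 2 :=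
          sum_le_sum_of_subset_of_nonneg hM fun _ _ _ => by positivity
      _ ≤ C ^ 2 * ∑ m ∈ range M, ‖x m‖ ^ 2 := h M x
      _ ≤ (C * ‖x‖) ^ 2 := by
          rw [mul_pow]
          gcongr
          exact hbessel M
  exact ⟨⟨_, memℓp_gen' hbound⟩, rfl, lp.norm_le_of_forall_sum_le hp (by positivity) hbound⟩

theorem SymbolBound.exists_hasSymbol (e : HilbertBasis ℕ ℂ H) (h : SymbolBound w φ C)
    (hC : 0 ≤ C) : ∃ B : H →L[ℂ] H, ‖B‖ ≤ C ∧ HasSymbol e w B φ := by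
  choose L hL hbound using fun v => h.exists_lp hC (e.repr v)
  let B : H →ₗ[ℂ] H :=
    { toFun := fun v => e.repr.symm (L v)
      map_add' := fun u v => by
        rw [← map_add]
        congr 1
        refine lp.ext ?_
        rw [hL, map_add, lp.coeFn_add, lp.coeFn_add, hL, hL]
        exact symbolCoord_add_right w φ _ _
      map_smul' := fun c v => by
        rw [RingHom.id_apply, ← map_smul]
        congr 1
        refine lp.ext ?_
        rw [hL, map_smul, lp.coeFn_smul, lp.coeFn_smul, hL]
        exact symbolCoord_smul_right w φ c _ }
  have hB : ∀ v, ‖B v‖ ≤ C * ‖v‖ := fun v => by simpa [B] using hbound v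
  refine ⟨B.mkContinuous C hB, B.mkContinuous_norm_le hC hB, fun v => ?_⟩
  simp [B, hL]

theorem HasSymbol.symbolBound (h : HasSymbol e w B φ) : SymbolBound w φ ‖B‖ := by
  intro M x
  have hp : 0 < (2 : ENNReal).toReal := by norm_num
  set y : lp (fun _ : ℕ => ℂ) 2 := ∑ n ∈ range M, lp.single 2 n (x n)
  have hy : ‖y‖ ^ 2 = ∑ n ∈ range M, ‖x n‖ ^ 2 := by
    simpa using lp.norm_sum_single hp x (range M)
  have hcoord : ∀ m ∈ range M, symbolCoord w φ x m = (e.repr (B (e.repr.symm y)) : ℕ → ℂ) m := by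
    intro m hm
    rw [h, e.repr.apply_symm_apply]
    refine sum_congr rfl fun p hp => ?_
    have hpM : p.2 < M :=
      (HasAntidiagonal.antidiagonal.snd_le hp).trans_lt (mem_range.1 hm)
    rw [lp.coeFn_sum, Finset.sum_apply]
    simp [Pi.single_apply, hpM]
  calc ∑ m ∈ range M, ‖symbolCoord w φ x m‖ ^ 2
      = ∑ m ∈ range M, ‖(e.repr (B (e.repr.symm y)) : ℕ → ℂ) m‖ ^ 2 :=
        sum_congr rfl fun m hm => by rw [hcoord m hm]
    _ ≤ ‖e.repr (B (e.repr.symm y))‖ ^ 2 := by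
        simpa using lp.sum_rpow_le_norm_rpow hp (e.repr (B (e.repr.symm y))) (range M)
    _ ≤ (‖B‖ * ‖y‖) ^ 2 := by
        gcongr
        simpa using B.le_opNorm (e.repr.symm y)
    _ = ‖B‖ ^ 2 * ∑ n ∈ range M, ‖x n‖ ^ 2 := by rw [mul_pow, hy]

/-- Along long runs of weights of modulus close to `1`, the matrix of `B` is close to the Toeplitz
matrix of `φ`, once the signs of the weights have been removed. -/
theorem HasSymbol.symbolBound_one (h : HasSymbol e w B φ) (hw : ∀ j, |w j| ≤ 1)
    (hruns : HasUnitRuns w) : SymbolBound 1 φ ‖B‖ := by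
  have habs : SymbolBound (fun j => |w j|) φ ‖B‖ := by
    convert h.symbolBound.mul_weights (t := fun j => (SignType.sign (w j) : ℝ)) fun j => ?_ using 1
    · ext j
      exact (sign_mul_self (w j)).symm
    · rcases lt_trichotomy (w j) 0 with h | h | h <;> simp [h]
  choose N hN using fun i : ℕ => hruns i (1 / ((i : ℝ) + 1)) Nat.one_div_pos_of_nat
  refine .of_tendsto (l := atTop) (fun i => habs.tail (N i)) (tendsto_pi_nhds.2 fun j => ?_)
    (fun _ => tendsto_const_nhds) tendsto_const_nhds
  have hlower : Tendsto (fun i : ℕ => 1 - 1 / ((i : ℝ) + 1)) atTop (𝓝 1) := by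
    simpa using tendsto_one_div_add_atTop_nhds_zero_nat.const_sub (1 : ℝ)
  refine tendsto_of_tendsto_of_tendsto_of_le_of_le' hlower tendsto_const_nhds ?_
    (.of_forall fun i => hw (N i + j))
  filter_upwards [eventually_gt_atTop j] with i hi using (hN i j hi).le

theorem exists_hasSymbol_taylorSeries (e : HilbertBasis ℕ ℂ H) (hw : ∀ j, |w j| ≤ 1)
    (f : hardyInfty) : ∃ B : H →L[ℂ] H, ‖B‖ ≤ ‖f‖ ∧ HasSymbol e w B (taylorSeries f) := by
  have hbound := ((symbolBound_one_iff (norm_nonneg f)).2 ⟨f, le_rfl, rfl⟩).mul_weights hw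
  exact (mul_one w ▸ hbound).exists_hasSymbol e (norm_nonneg f)

/-- The operator `∑ₖ aₖ Tᵏ`, where `f = ∑ₖ aₖ zᵏ` and `T` is the weighted shift with weights `w` of
modulus at most `1`. -/
noncomputable def calculusFun (e : HilbertBasis ℕ ℂ H) (hw : ∀ j, |w j| ≤ 1) (f : hardyInfty) :
    H →L[ℂ] H :=
  (exists_hasSymbol_taylorSeries e hw f).choose

theorem hasSymbol_calculusFun (hw : ∀ j, |w j| ≤ 1) (f : hardyInfty) :
    HasSymbol e w (calculusFun e hw f) (taylorSeries f) :=
  (exists_hasSymbol_taylorSeries e hw f).choose_spec.2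

theorem calculusFun_algebraMap (hw : ∀ j, |w j| ≤ 1) (c : ℂ) :
    calculusFun e hw (algebraMap ℂ hardyInfty c) = algebraMap ℂ (H →L[ℂ] H) c :=
  (hasSymbol_calculusFun hw _).unique <| by
    rw [AlgHom.commutes]
    exact hasSymbol_algebraMap e w c

/-- The `H^∞` functional calculus of the weighted shift with weights `w` of modulus at most `1`. -/
noncomputable def calculus (e : HilbertBasis ℕ ℂ H) (hw : ∀ j, |w j| ≤ 1) :
    hardyInfty →ₐ[ℂ] (H →L[ℂ] H) where
  toFun := calculusFun e hw
  map_one' := by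
    rw [← map_one (algebraMap ℂ hardyInfty), calculusFun_algebraMap, map_one]
  map_mul' f g := (hasSymbol_calculusFun hw _).unique <| by
    rw [map_mul]
    exact (hasSymbol_calculusFun hw f).mul (hasSymbol_calculusFun hw g)
  map_zero' := by
    rw [← map_zero (algebraMap ℂ hardyInfty), calculusFun_algebraMap, map_zero]
  map_add' f g := (hasSymbol_calculusFun hw _).unique <| by
    rw [map_add]
    exact (hasSymbol_calculusFun hw f).add (hasSymbol_calculusFun hw g)
  commutes' := calculusFun_algebraMap hw

theorem hasSymbol_calculus (hw : ∀ j, |w j| ≤ 1) (f : hardyInfty) :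
    HasSymbol e w (calculus e hw f) (taylorSeries f) :=
  hasSymbol_calculusFun hw f

theorem norm_calculus_le (hw : ∀ j, |w j| ≤ 1) (f : hardyInfty) : ‖calculus e hw f‖ ≤ ‖f‖ :=
  (exists_hasSymbol_taylorSeries e hw f).choose_spec.1

theorem isometry_calculus (hw : ∀ j, |w j| ≤ 1) (hruns : HasUnitRuns w) :
    Isometry (calculus e hw) := by
  refine AddMonoidHomClass.isometry_of_norm _ fun f => (norm_calculus_le hw f).antisymm ?_
  obtain ⟨g, hg, hgf⟩ := (symbolBound_one_iff (norm_nonneg _)).1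
    ((hasSymbol_calculus (e := e) hw f).symbolBound_one hw hruns)
  exact taylorSeries_injective hgf ▸ hg

theorem range_calculus (hw : ∀ j, |w j| ≤ 1) (hruns : HasUnitRuns w) :
    (calculus e hw).range = symbolAlgebra e w := by
  apply le_antisymm
  · rintro _ ⟨f, rfl⟩
    exact ⟨_, hasSymbol_calculus hw f⟩
  · rintro B ⟨φ, hB⟩
    obtain ⟨f, -, rfl⟩ := (symbolBound_one_iff (norm_nonneg _)).1 (hB.symbolBound_one hw hruns)
    exact ⟨f, (hasSymbol_calculus hw f).unique hB⟩

theorem calculus_restrictDisk_diskCoordinate (hw : ∀ j, |w j| ≤ 1) :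
    calculus e hw (restrictDisk diskCoordinate) = weightedShift e w := by
  have h := hasSymbol_calculus (e := e) hw (restrictDisk diskCoordinate)
  rw [taylorSeries_restrictDisk_diskCoordinate] at h
  exact h.unique (hasSymbol_weightedShift e ⟨1, hw⟩)

end Symbol

section Convergence

variable {ι κ : Type*} {l : Filter ι} {H : Type*} [NormedAddCommGroup H] [InnerProductSpace ℂ H]

theorem tendsto_apply_of_tendsto_basis {F : Type*} [NormedAddCommGroup F] [NormedSpace ℂ F]
    (e : HilbertBasis κ ℂ H) {L : ι → H →L[ℂ] F} {L₀ : H →L[ℂ] F} {C : ℝ} (hC : ∀ j, ‖L j‖ ≤ C)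
    (h : ∀ n, Tendsto (fun j => L j (e n)) l (𝓝 (L₀ (e n)))) (x : H) :
    Tendsto (fun j => L j x) l (𝓝 (L₀ x)) := by
  have hequi : Equicontinuous fun j => (L j : H → F) :=
    (LipschitzWith.uniformEquicontinuous _ C.toNNReal fun j => (L j).lipschitz.weaken
      (NNReal.le_toNNReal_of_coe_le (hC j))).equicontinuous
  have hclosed : IsClosed {x | Tendsto (fun j => L j x) l (𝓝 (L₀ x))} :=
    hequi.isClosed_setOfPred_tendsto L₀.continuous
  have hspan : ∀ x ∈ Submodule.span ℂ (Set.range e),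
      Tendsto (fun j => L j x) l (𝓝 (L₀ x)) := by
    intro x hx
    induction hx using Submodule.span_induction with
    | mem x hx => obtain ⟨n, rfl⟩ := hx; exact h n
    | zero => simpa using tendsto_const_nhds
    | add x y _ _ hx hy => simpa using hx.add hy
    | smul c x _ hx => simpa using hx.const_smul c
  exact closure_minimal hspan hclosed
    (Submodule.dense_iff_topologicalClosure_eq_top.2 e.dense_span x)

theorem tendsto_inner_of_tendsto_entries (e : HilbertBasis κ ℂ H) {A : ι → H →L[ℂ] H}
    {B : H →L[ℂ] H} {C : ℝ} (hC : ∀ j, ‖A j‖ ≤ C)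
    (h : ∀ m n, Tendsto (fun j => inner ℂ (e m) (A j (e n))) l (𝓝 (inner ℂ (e m) (B (e n)))))
    (y x : H) : Tendsto (fun j => inner ℂ y (A j x)) l (𝓝 (inner ℂ y (B x))) := by
  have hcolumn : ∀ m, Tendsto (fun j => inner ℂ (e m) (A j x)) l (𝓝 (inner ℂ (e m) (B x))) := by
    intro m
    refine tendsto_apply_of_tendsto_basis e (L := fun j => innerSL ℂ (e m) ∘L A j)
      (L₀ := innerSL ℂ (e m) ∘L B) (C := C) (fun j => ?_) (h m) x
    refine (ContinuousLinearMap.opNorm_comp_le _ _).trans ?_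
    rw [innerSL_apply_norm, e.orthonormal.1, one_mul]
    exact hC j
  have hconj : Tendsto (fun j => inner ℂ (A j x) y) l (𝓝 (inner ℂ (B x) y)) := by
    refine tendsto_apply_of_tendsto_basis e (L := fun j => innerSL ℂ (A j x))
      (L₀ := innerSL ℂ (B x)) (C := C * ‖x‖) (fun j => ?_) (fun m => ?_) y
    · rw [innerSL_apply_norm]
      exact (A j).le_of_opNorm_le (hC j) x
    · simpa [Function.comp_def, inner_conj_symm] using
        (Complex.continuous_conj.tendsto _).comp (hcolumn m)
  simpa [Function.comp_def, inner_conj_symm] using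
    (Complex.continuous_conj.tendsto _).comp hconj

theorem sum_norm_inner_mul_le (e : HilbertBasis κ ℂ H) (y z : H) (s : Finset κ) :
    ∑ k ∈ s, ‖inner ℂ y (e k) * inner ℂ (e k) z‖ ≤ ‖y‖ * ‖z‖ := by
  have hbessel : ∀ z : H, √(∑ k ∈ s, ‖inner ℂ (e k) z‖ ^ 2) ≤ ‖z‖ := fun z =>
    Real.sqrt_le_iff.2 ⟨norm_nonneg z, e.orthonormal.sum_inner_products_le z⟩
  calc ∑ k ∈ s, ‖inner ℂ y (e k) * inner ℂ (e k) z‖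
      = ∑ k ∈ s, ‖inner ℂ (e k) y‖ * ‖inner ℂ (e k) z‖ := by
        simp only [norm_mul, norm_inner_symm y]
    _ ≤ √(∑ k ∈ s, ‖inner ℂ (e k) y‖ ^ 2) * √(∑ k ∈ s, ‖inner ℂ (e k) z‖ ^ 2) :=
        Real.sum_mul_le_sqrt_mul_sqrt s _ _
    _ ≤ ‖y‖ * ‖z‖ := mul_le_mul (hbessel y) (hbessel z) (Real.sqrt_nonneg _) (norm_nonneg y)

theorem trace_comp_eq_tsum (e : HilbertBasis ℕ ℂ H) {S : H →L[ℂ] H} {x y : ℕ → H}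
    (hxy : Summable fun n => ‖x n‖ * ‖y n‖)
    (hS : ∀ v : H, HasSum (fun n => inner ℂ (y n) v • x n) (S v)) (A : H →L[ℂ] H) :
    trace e (A ∘L S) = ∑' n, inner ℂ (y n) (A (x n)) := by
  let F : ℕ → ℕ → ℂ := fun n k => inner ℂ (y n) (e k) * inner ℂ (e k) (A (x n))
  have hrow : ∀ n, Summable fun k => ‖F n k‖ := fun n =>
    summable_of_sum_le (fun _ => norm_nonneg _) (sum_norm_inner_mul_le e (y n) (A (x n)))
  have hrow_le : ∀ n, ∑' k, ‖F n k‖ ≤ ‖A‖ * (‖x n‖ * ‖y n‖) := fun n => calc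
    ∑' k, ‖F n k‖ ≤ ‖y n‖ * ‖A (x n)‖ :=
      (hrow n).tsum_le_of_sum_le (sum_norm_inner_mul_le e (y n) (A (x n)))
    _ ≤ ‖y n‖ * (‖A‖ * ‖x n‖) := by gcongr; exact A.le_opNorm _
    _ = ‖A‖ * (‖x n‖ * ‖y n‖) := by ring
  have hsum : Summable (Function.uncurry F) := by
    refine .of_norm ((summable_prod_of_nonneg fun _ => norm_nonneg _).2 ⟨hrow, ?_⟩)
    exact .of_nonneg_of_le (fun n => tsum_nonneg fun _ => norm_nonneg _) hrow_le (hxy.mul_left _)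
  have hdiag : ∀ k, inner ℂ (e k) ((A ∘L S) (e k)) = ∑' n, F n k := by
    intro k
    have hk := (hS (e k)).mapL (innerSL ℂ (e k) ∘L A)
    simpa [F, inner_smul_right] using hk.tsum_eq.symm
  rw [trace, tsum_congr hdiag, hsum.tsum_comm]
  exact tsum_congr fun n => e.tsum_inner_mul_inner _ _

theorem tendsto_weakStar_of_tendsto_inner (e : HilbertBasis ℕ ℂ H) {A : ι → H →L[ℂ] H}
    {B : H →L[ℂ] H} {C : ℝ} (hC : ∀ j, ‖A j‖ ≤ C)
    (h : ∀ y x, Tendsto (fun j => inner ℂ y (A j x)) l (𝓝 (inner ℂ y (B x)))) :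
    Tendsto A l (@nhds _ (weakStarTopology e) B) := by
  rw [weakStarTopology, nhds_iInf, tendsto_iInf]
  rintro ⟨S, x, y, hxy, hS⟩
  rw [nhds_induced, tendsto_comap_iff]
  simp only [Function.comp_def, trace_comp_eq_tsum e hxy hS]
  refine tendsto_tsum_of_dominated_convergence (hxy.mul_left C) (fun n => h _ _)
    (.of_forall fun j n => ?_)
  calc ‖inner ℂ (y n) (A j (x n))‖ ≤ ‖y n‖ * ‖A j (x n)‖ := norm_inner_le_norm _ _
    _ ≤ ‖y n‖ * (C * ‖x n‖) := by gcongr; exact (A j).le_of_opNorm_le (hC j) _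
    _ = C * (‖x n‖ * ‖y n‖) := by ring

theorem isTraceClass_smulRight (y x : H) : IsTraceClass ((innerSL ℂ y).smulRight x) := by
  refine ⟨Pi.single 0 x, Pi.single 0 y, summable_of_ne_finset_zero (s := {0}) fun i hi => ?_,
    fun v => ?_⟩
  · simp [Finset.notMem_singleton.1 hi]
  · convert hasSum_single (f := fun i => inner ℂ ((Pi.single 0 y : ℕ → H) i) v •
      (Pi.single 0 x : ℕ → H) i) 0 fun i hi => ?_ using 1
    · simp
    · simp [hi]

theorem trace_comp_smulRight (e : HilbertBasis ℕ ℂ H) (B : H →L[ℂ] H) (y x : H) :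
    trace e (B ∘L (innerSL ℂ y).smulRight x) = inner ℂ y (B x) := by
  simp [trace, e.tsum_inner_mul_inner]

theorem continuous_inner_weakStar (e : HilbertBasis ℕ ℂ H) (y x : H) :
    @Continuous _ _ (weakStarTopology e) _ fun B : H →L[ℂ] H => inner ℂ y (B x) := by
  simp only [← trace_comp_smulRight e]
  exact continuous_iInf_dom (i := ⟨_, isTraceClass_smulRight y x⟩) continuous_induced_dom

end Convergence

section SymbolAlgebra

open Polynomial

variable {H : Type*} [NormedAddCommGroup H] [InnerProductSpace ℂ H] {e : HilbertBasis ℕ ℂ H}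
  {w : ℕ → ℝ}

theorem HasUnitRuns.exists_weightProd_ne_zero (hruns : HasUnitRuns w) (k : ℕ) :
    ∃ n, weightProd w n (n + k) ≠ 0 := by
  obtain ⟨N, hN⟩ := hruns k 1 one_pos
  refine ⟨N, prod_ne_zero_iff.2 fun j hj => ?_⟩
  obtain ⟨hNj, hjN⟩ := mem_Ico.1 hj
  have hpos := hN (j - N) (by lia)
  rw [Nat.add_sub_cancel' hNj, sub_self, abs_pos] at hpos
  exact_mod_cast hpos

theorem mem_symbolAlgebra_iff (hne : ∀ k, ∃ n, weightProd w n (n + k) ≠ 0) {B : H →L[ℂ] H} :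
    B ∈ symbolAlgebra e w ↔
      (∀ m n, m < n → inner ℂ (e m) (B (e n)) = 0) ∧
      ∀ k m n, inner ℂ (e (m + k)) (B (e m)) * weightProd w n (n + k) =
        inner ℂ (e (n + k)) (B (e n)) * weightProd w m (m + k) := by
  constructor
  · rintro ⟨φ, hφ⟩
    rw [hasSymbol_iff_entries] at hφ
    refine ⟨fun m n hmn => by rw [hφ, if_neg hmn.not_ge], fun k m n => ?_⟩
    simp only [hφ, Nat.le_add_right, if_true, Nat.add_sub_cancel_left]
    ring
  · rintro ⟨hlower, hdiag⟩
    choose N hN using hne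
    refine ⟨PowerSeries.mk fun k => inner ℂ (e (N k + k)) (B (e (N k))) /
      weightProd w (N k) (N k + k), hasSymbol_iff_entries.2 fun m n => ?_⟩
    split_ifs with h
    · obtain ⟨k, rfl⟩ := Nat.exists_eq_add_of_le h
      rw [PowerSeries.coeff_mk, Nat.add_sub_cancel_left, div_mul_eq_mul_div, eq_div_iff (hN k)]
      exact hdiag k n (N k)
    · exact hlower m n (not_le.1 h)

theorem isClosed_symbolAlgebra (hne : ∀ k, ∃ n, weightProd w n (n + k) ≠ 0)
    (τ : TopologicalSpace (H →L[ℂ] H))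
    (hτ : ∀ m n, @Continuous _ _ τ _ fun B : H →L[ℂ] H => inner ℂ (e m) (B (e n))) :
    @IsClosed _ τ (symbolAlgebra e w : Set (H →L[ℂ] H)) := by
  let := τ
  have heq : (symbolAlgebra e w : Set (H →L[ℂ] H)) =
      (⋂ (m) (n) (_ : m < n), {B | inner ℂ (e m) (B (e n)) = 0}) ∩
      ⋂ (k) (m) (n), {B | inner ℂ (e (m + k)) (B (e m)) * weightProd w n (n + k) =
        inner ℂ (e (n + k)) (B (e n)) * weightProd w m (m + k)} := by
    ext B
    simp [mem_symbolAlgebra_iff hne]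
  rw [heq]
  refine .inter ?_ ?_
  · exact isClosed_iInter fun m => isClosed_iInter fun n => isClosed_iInter fun _ =>
      isClosed_eq (hτ m n) continuous_const
  · exact isClosed_iInter fun k => isClosed_iInter fun m => isClosed_iInter fun n =>
      isClosed_eq ((hτ _ _).mul continuous_const) ((hτ _ _).mul continuous_const)

theorem hasSymbol_aeval_weightedShift (hw : ∃ C : ℝ, ∀ n, |w n| ≤ C) (p : ℂ[X]) :
    HasSymbol e w (aeval (weightedShift e w) p) p := by
  induction p using Polynomial.induction_on with
  | C c => simpa using hasSymbol_algebraMap e w c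
  | add p q hp hq => simpa using hp.add hq
  | monomial n c h =>
    simpa [pow_succ, ← mul_assoc] using h.mul (hasSymbol_weightedShift e hw)

theorem HasSymbol.exists_polynomial_tendsto {B : H →L[ℂ] H} {φ : ℂ⟦X⟧} (h : HasSymbol e w B φ)
    (hw : ∀ j, |w j| ≤ 1) (hruns : HasUnitRuns w) :
    ∃ p : ℕ → ℂ[X], (∀ j, ‖aeval (weightedShift e w) (p j)‖ ≤ ‖B‖ + 1) ∧
      ∀ y x, Tendsto (fun j => inner ℂ y (aeval (weightedShift e w) (p j) x)) atTop
        (𝓝 (inner ℂ y (B x))) := by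
  obtain ⟨f, hf, hfφ⟩ := (symbolBound_one_iff (norm_nonneg B)).1 (h.symbolBound_one hw hruns)
  obtain ⟨p, hp, hcoeff⟩ := (taylorSeries_eq_iff.1 hfφ).exists_polynomial_approx
    fun z => (f.1.norm_coe_le_norm z).trans hf
  have hsymbol := fun j => hasSymbol_aeval_weightedShift (e := e) ⟨1, hw⟩ (p j)
  have hbound : ∀ j, ‖aeval (weightedShift e w) (p j)‖ ≤ ‖B‖ + 1 := by
    intro j
    have hj : ∀ z : ℂ, ‖z‖ = 1 → ‖(p j).eval z‖ ≤ ‖B‖ + 1 := fun z hz => (hp j z hz.le).trans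
      (by gcongr; exact div_le_one_of_le₀ (by simp) (by positivity))
    have hj' := (SymbolBound.of_polynomial (p j) hj).mul_weights hw
    obtain ⟨A, hA, hAp⟩ := (mul_one w ▸ hj').exists_hasSymbol e (by positivity)
    rwa [← hAp.unique (hsymbol j)]
  refine ⟨p, hbound, tendsto_inner_of_tendsto_entries e hbound fun m n => ?_⟩
  simp only [hasSymbol_iff_entries.1 h, hasSymbol_iff_entries.1 (hsymbol _)]
  split_ifs
  · simpa using (hcoeff (m - n)).mul_const _
  · exact tendsto_const_nhds

theorem closure_polynomialsIn_weightedShift (hw : ∀ j, |w j| ≤ 1) (hruns : HasUnitRuns w)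
    (τ : TopologicalSpace (H →L[ℂ] H))
    (hτ : ∀ m n, @Continuous _ _ τ _ fun B : H →L[ℂ] H => inner ℂ (e m) (B (e n)))
    (hlim : ∀ (A : ℕ → H →L[ℂ] H) (B : H →L[ℂ] H) (C : ℝ), (∀ j, ‖A j‖ ≤ C) →
      (∀ y x, Tendsto (fun j => inner ℂ y (A j x)) atTop (𝓝 (inner ℂ y (B x)))) →
        Tendsto A atTop (@nhds _ τ B)) :
    @closure _ τ (polynomialsIn (weightedShift e w) : Set (H →L[ℂ] H)) = symbolAlgebra e w := by
  let := τ
  have hclosed := isClosed_symbolAlgebra hruns.exists_weightProd_ne_zero τ hτ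
  refine (closure_minimal ?_ hclosed).antisymm ?_
  · rintro _ ⟨p, rfl⟩
    exact ⟨_, hasSymbol_aeval_weightedShift ⟨1, hw⟩ p⟩
  · rintro B ⟨φ, hB⟩
    obtain ⟨p, hp, hlimp⟩ := hB.exists_polynomial_tendsto hw hruns
    exact mem_closure_of_tendsto (hlim _ _ _ hp hlimp) (.of_forall fun j => ⟨p j, rfl⟩)

theorem dualAlgebraGen_weightedShift (hw : ∀ j, |w j| ≤ 1) (hruns : HasUnitRuns w) :
    dualAlgebraGen e (weightedShift e w) = symbolAlgebra e w :=
  closure_polynomialsIn_weightedShift hw hruns _ (fun _ _ => continuous_inner_weakStar e _ _)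
    fun _ _ _ => tendsto_weakStar_of_tendsto_inner e

theorem weaklyClosedAlgebraGen_weightedShift (hw : ∀ j, |w j| ≤ 1) (hruns : HasUnitRuns w) :
    weaklyClosedAlgebraGen (weightedShift e w) = (symbolAlgebra e w : Set (H →L[ℂ] H)) := by
  have : CompleteSpace H :=
    (completeSpace_congr (e := e.repr.toEquiv) e.repr.isometry.isUniformEmbedding).2 inferInstance
  have hcont : ∀ m n, Continuous fun B : H →WOT[ℂ] H => inner ℂ (e m) (B (e n)) := fun m n =>
    ContinuousLinearMapWOT.continuous_dual_apply (e n) (innerSL ℂ (e m))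
  let τ : TopologicalSpace (H →L[ℂ] H) := .induced ContinuousLinearMapWOT.ofCLM inferInstance
  rw [← closure_polynomialsIn_weightedShift hw hruns τ
    (fun m n => (hcont m n).comp continuous_induced_dom) fun A B C _ h => ?_]
  · exact Set.ext fun B => closure_induced.symm
  · rw [nhds_induced, tendsto_comap_iff,
      ContinuousLinearMapWOT.tendsto_iff_forall_inner_apply_tendsto]
    exact fun x y => h y x

theorem range_calculus_comp_restrictDisk (hw : ∀ j, |w j| ≤ 1) (hruns : HasUnitRuns w) :
    ((calculus e hw).comp restrictDisk).range = banachAlgebraGen (weightedShift e w) := by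
  have h := range_eq_banachAlgebraGen (Θ := (calculus e hw).comp restrictDisk)
    ((isometry_calculus hw hruns).comp isometry_restrictDisk) denseRange_aeval_diskCoordinate
  rwa [AlgHom.comp_apply, calculus_restrictDisk_diskCoordinate] at h

end SymbolAlgebra

section Commutant

variable {H : Type*} [NormedAddCommGroup H] [InnerProductSpace ℂ H] {e : HilbertBasis ℕ ℂ H}
  {w : ℕ → ℝ}

theorem mem_symbolAlgebra_of_commute (hw : ∃ C : ℝ, ∀ n, |w n| ≤ C) (hw0 : ∀ n, w n ≠ 0)
    {B : H →L[ℂ] H} (hB : Commute B (weightedShift e w)) : B ∈ symbolAlgebra e w := by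
  set φ : ℂ⟦X⟧ := PowerSeries.mk fun k => inner ℂ (e k) (B (e 0)) / weightProd w 0 k
  have hT := hasSymbol_weightedShift e hw
  refine ⟨φ, hasSymbol_iff_basis.2 fun n => ?_⟩
  induction n with
  | zero =>
    ext m
    simp [φ, symbolCoord_basis, e.repr_apply_apply, weightProd_ne_zero hw0]
  | succ n ih =>
    have hTn : ((w n : ℂ) • e.repr (e (n + 1)) : ℕ → ℂ) =
        symbolCoord w PowerSeries.X (e.repr (e n)) := by
      rw [← hT, weightedShift_apply_basis e hw, map_smul, lp.coeFn_smul]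
    have hwn : (w n : ℂ) ≠ 0 := by exact_mod_cast hw0 n
    refine smul_right_injective (ℕ → ℂ) hwn ?_
    calc (w n : ℂ) • (e.repr (B (e (n + 1))) : ℕ → ℂ)
        = e.repr (B (weightedShift e w (e n))) := by
          rw [weightedShift_apply_basis e hw, map_smul, map_smul, lp.coeFn_smul]
      _ = e.repr (weightedShift e w (B (e n))) := by
          rw [← mul_apply_eq_comp, hB.eq, mul_apply_eq_comp]
      _ = symbolCoord w φ (symbolCoord w PowerSeries.X (e.repr (e n))) := by
          rw [hT, ih, symbolCoord_symbolCoord, symbolCoord_symbolCoord, mul_comm]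
      _ = (w n : ℂ) • symbolCoord w φ (e.repr (e (n + 1))) := by
          rw [← hTn, symbolCoord_smul_right]

theorem weightedShift_mem_symbolAlgebra (hw : ∃ C : ℝ, ∀ n, |w n| ≤ C) :
    weightedShift e w ∈ symbolAlgebra e w :=
  ⟨_, hasSymbol_weightedShift e hw⟩

theorem commutant_weightedShift (hw : ∃ C : ℝ, ∀ n, |w n| ≤ C) (hw0 : ∀ n, w n ≠ 0) :
    commutant (weightedShift e w) = symbolAlgebra e w := by
  refine le_antisymm (fun B hB => ?_) fun B hB => ?_
  · exact mem_symbolAlgebra_of_commute hw hw0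
      ((Subalgebra.mem_centralizer_iff ℂ).1 hB _ (Set.mem_singleton _)).symm
  · refine (Subalgebra.mem_centralizer_iff ℂ).2 ?_
    rintro _ rfl
    exact commute_of_mem_symbolAlgebra (weightedShift_mem_symbolAlgebra hw) hB

theorem doubleCommutant_weightedShift (hw : ∃ C : ℝ, ∀ n, |w n| ≤ C) (hw0 : ∀ n, w n ≠ 0) :
    doubleCommutant (weightedShift e w) = symbolAlgebra e w := by
  refine le_antisymm ?_ fun B hB => ?_
  · rw [← commutant_weightedShift hw hw0]
    refine Subalgebra.centralizer_le _ _ _ (Set.singleton_subset_iff.2 ?_)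
    rw [commutant_weightedShift hw hw0]
    exact weightedShift_mem_symbolAlgebra hw
  · refine (Subalgebra.mem_centralizer_iff ℂ).2 fun A hA => ?_
    rw [commutant_weightedShift hw hw0] at hA
    exact commute_of_mem_symbolAlgebra hA hB

end Commutant

end RandomShift

open RandomShift in
theorem theorem8p1_general {Ω : Type*} [MeasurableSpace Ω] (P : Measure Ω)
    {H : Type*} [NormedAddCommGroup H] [InnerProductSpace ℂ H]
    (e : HilbertBasis ℕ ℂ H) (X : ℕ → Ω → ℝ)
    (hmeas : ∀ n, Measurable (X n))
    (hindep : iIndepFun X P)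
    (hident : ∀ n, IdentDistrib (X n) (X 0) P P)
    (hR : IsGreatest (essRange (fun ω => |X 0 ω|) P) 1)
    (T : Ω → H →L[ℂ] H)
    (hT : ∀ ω, T ω = weightedShift e (fun n => X n ω)) :
    (∀ᵐ ω ∂P, ∃ φ : banachAlgebraGen (T ω) ≃ₐ[ℂ] diskAlgebra, Isometry φ) ∧
    (∀ᵐ ω ∂P, dualAlgebraGen e (T ω) = weaklyClosedAlgebraGen (T ω)) ∧
    (P {ω | X 0 ω = 0} = 0 →
      ∀ᵐ ω ∂P,
        dualAlgebraGen e (T ω) = weaklyClosedAlgebraGen (T ω) ∧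
        weaklyClosedAlgebraGen (T ω) = (commutant (T ω) : Set (H →L[ℂ] H)) ∧
        commutant (T ω) = doubleCommutant (T ω) ∧
        ∃ φ : commutant (T ω) ≃ₐ[ℂ] hardyInfty, Isometry φ) := by
  have hruns := ae_hasUnitRuns hmeas hindep hident hR.1
  have hbd : ∀ᵐ ω ∂P, ∀ n, |X n ω| ≤ 1 :=
    ae_forall_of_identDistrib hident (measurableSet_le measurable_abs measurable_const)
      (ae_le_of_mem_upperBounds_essRange (hmeas 0).abs.aemeasurable hR.2)
  refine ⟨?_, ?_, fun h0 => ?_⟩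
  · filter_upwards [hruns, hbd] with ω hr hw
    rw [hT]
    exact exists_isometric_algEquiv (Θ := (calculus e hw).comp restrictDisk)
      ((isometry_calculus hw hr).comp isometry_restrictDisk)
      (range_calculus_comp_restrictDisk hw hr)
  · filter_upwards [hruns, hbd] with ω hr hw
    rw [hT, dualAlgebraGen_weightedShift hw hr, weaklyClosedAlgebraGen_weightedShift hw hr]
  · have hne : ∀ᵐ ω ∂P, ∀ n, X n ω ≠ 0 :=
      ae_forall_of_identDistrib hident (measurableSet_singleton 0).compl
        (measure_eq_zero_iff_ae_notMem.1 h0)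
    filter_upwards [hruns, hbd, hne] with ω hr hw hne
    rw [hT, dualAlgebraGen_weightedShift hw hr, weaklyClosedAlgebraGen_weightedShift hw hr,
      commutant_weightedShift ⟨1, hw⟩ hne, doubleCommutant_weightedShift ⟨1, hw⟩ hne]
    exact ⟨rfl, rfl, rfl, exists_isometric_algEquiv (isometry_calculus hw hr)
      (range_calculus hw hr)⟩

/-- Weights and basis vectors are indexed from `0`: the shift `T ω` maps `e n` to
`X n ω • e (n + 1)`. -/
theorem theorem8p1 {Ω : Type*} [MeasurableSpace Ω] (P : Measure Ω) [IsProbabilityMeasure P]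
    {H : Type*} [NormedAddCommGroup H] [InnerProductSpace ℂ H] [CompleteSpace H]
    (e : HilbertBasis ℕ ℂ H) (X : ℕ → Ω → ℝ)
    (hmeas : ∀ n, Measurable (X n))
    (hnonneg : ∀ n, ∀ᵐ ω ∂P, 0 ≤ X n ω)
    (hindep : iIndepFun X P)
    (hident : ∀ n, IdentDistrib (X n) (X 0) P P)
    (hR : IsGreatest (RandomShift.essRange (X 0) P) 1)
    (T : Ω → H →L[ℂ] H)
    (hT : ∀ ω, T ω = RandomShift.weightedShift e (fun n => X n ω)) :
    (∀ᵐ ω ∂P, ∃ φ : RandomShift.banachAlgebraGen (T ω) ≃ₐ[ℂ] RandomShift.diskAlgebra,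
      Isometry φ) ∧
    (∀ᵐ ω ∂P,
      RandomShift.dualAlgebraGen e (T ω) = RandomShift.weaklyClosedAlgebraGen (T ω)) ∧
    (P {ω | X 0 ω = 0} = 0 →
      ∀ᵐ ω ∂P,
        RandomShift.dualAlgebraGen e (T ω) = RandomShift.weaklyClosedAlgebraGen (T ω) ∧
        RandomShift.weaklyClosedAlgebraGen (T ω) =
          (RandomShift.commutant (T ω) : Set (H →L[ℂ] H)) ∧
        RandomShift.commutant (T ω) = RandomShift.doubleCommutant (T ω) ∧
        ∃ φ : RandomShift.commutant (T ω) ≃ₐ[ℂ] RandomShift.hardyInfty, Isometry φ) := by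
  have habs : X 0 =ᵐ[P] fun ω => |X 0 ω| := (hnonneg 0).mono fun ω h => (abs_of_nonneg h).symm
  exact theorem8p1_general P e X hmeas hindep hident (RandomShift.essRange_congr habs ▸ hR) T hT
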